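/- Let $S$ be a measurable space and let $\nu$ be a $\sigma$-finite complex measure on $S$, i.e. $\nu(dx)=\theta(x)\,|\nu|(dx)$ with $|\nu|$ a $\sigma$-finite positive measure (possibly of infinite mass) and $\theta:S\to\mathbb C$ measurable with $|\theta|=1$. Let $w:S\times S\to\{u\in\mathbb C:|u|\le 1\}$ be measurable and symmetric. For $n\ge 1$ put $$\omega_n(x_1,\dots,x_n)=\prod_{1\le i<j\le n}w(x_i,x_j),\qquad \omega^T_n(x_1,\dots,x_n)=\sum_{G}\ \prod_{\{i,j\}\in E(G)}[w(x_i,x_j)-1],$$ where $G$ runs over the connected graphs with vertex set $\{1,\dots,n\}$ (so $\omega^T_1=1$). For measurable $\Lambda\subset S$ with $|\nu|(\Lambda)<\infty$ and $z\in\mathbb C$ let $$\Xi_\Lambda(z\nu)=1+\sum_{n\ge1}\frac{z^n}{n!}\int_{\Lambda^n}\omega_n(x_1,\dots,x_n)\,\nu(dx_1)\cdots\nu(dx_n),$$ and let $\ln\Xi_\Lambda(\nu)$ denote the value at $z=1$ of the continuous branch of $z\mapsto\ln\Xi_\Lambda(z\nu)$ on the closed unit disc that vanishes at $z=0$, if such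 a branch exists (it is then unique). Define the pinned and the absolute pinned cluster expansions $$\Gamma(\nu)(x)=\sum_{n\ge0}\frac1{n!}\int_{S^n}\omega^T_{n+1}(x,x_1,\dots,x_n)\,\nu(dx_1)\cdots\nu(dx_n),$$ $$|\Gamma|(\nu)(x)=\sum_{n\ge0}\frac1{n!}\int_{S^n}|\omega^T_{n+1}(x,x_1,\dots,x_n)|\,|\nu|(dx_1)\cdots|\nu|(dx_n)\in[0,\infty],$$ and, for $\mu:S\to[0,\infty]$, $$\Psi(\mu)(x)=1+\sum_{n\ge1}\frac1{n!}\int_{S^n}\prod_{i=1}^n|w(x,x_i)-1|\prod_{1\le i<j\le n}|w(x_i,x_j)|\ \prod_{i=1}^n\mu(x_i)\,|\nu|(dx_i).$$ Suppose that $\Psi(\mu)(x)\le\mu(x)$ for all $x\in S$. Then: (i) For every $x\in S$, $|\Gamma(\nu)(x)|\le|\Gamma|(\nu)(x)\le\mu(x)$. In particular, at every $x$ with $\mu(x)<\infty$ all the integrals in $\Gamma(\nu)(x)$ and the series itself converge absolutely. (At the points where $\mu(x)=\infty$ the first inequality is read with the convention that a divergent integral or series has the value $0$.) (ii) For every measurable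 $\Lambda\subset S$ with $|\nu|(\Lambda)<\infty$, $$\sum_{n\ge1}\frac1{n!}\int_{\Lambda^n}|\omega^T_n(x_1,\dots,x_n)|\,|\nu|(dx_1)\cdots|\nu|(dx_n)\ \le\ \int_\Lambda\mu\,d|\nu|.$$ If moreover $\mu<\infty$ $|\nu|$-almost everywhere on $\Lambda$, then the left-hand side is finite, $\ln\Xi_\Lambda(\nu)$ exists, the cluster expansion $$\ln\Xi_\Lambda(\nu)=\sum_{n\ge1}\frac1{n!}\int_{\Lambda^n}\omega^T_n(x_1,\dots,x_n)\,\nu(dx_1)\cdots\nu(dx_n)$$ holds with absolutely convergent integrals and series, and $$|\ln\Xi_\Lambda(\nu)|\ \le\ \sum_{n\ge1}\frac1{n!}\int_{\Lambda^n}|\omega^T_n(x_1,\dots,x_n)|\,|\nu|(dx_1)\cdots|\nu|(dx_n)\ \le\ \int_\Lambda\mu\,d|\nu|.$$ -/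

import Mathlib

open MeasureTheory
open scoped ENNReal Nat

noncomputable section

namespace PinnedCluster

/-- A σ-finite complex measure `ν` on `S`, given by its polar decomposition
`ν(dx) = phase(x) |ν|(dx)`: the total variation `|ν|` is a σ-finite positive measure, possibly of
infinite mass, and the phase is a measurable unimodular function. Thus `ν(A) = ∫_A phase d|ν|`
whenever `|ν|(A) < ∞`. A positive measure has phase `1`; a measure `ξ(x) dx` with complex density
`ξ` has total variation `|ξ(x)| dx` and phase `ξ/|ξ|`. -/
structure SigmaFiniteComplexMeasure (S : Type*) [MeasurableSpace S] where
  /-- the total variation measure `|ν|` -/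
  variation : Measure S
  sigmaFinite : SigmaFinite variation
  /-- the Radon-Nikodym density of `ν` with respect to `|ν|` -/
  phase : S → ℂ
  measurable_phase : Measurable phase
  norm_phase : ∀ x, ‖phase x‖ = 1

attribute [instance] SigmaFiniteComplexMeasure.sigmaFinite

variable {S : Type*} [MeasurableSpace S]

/-- The positive product measure `|ν|(dx₁) ⋯ |ν|(dxₙ)` on `Sⁿ`. -/
def SigmaFiniteComplexMeasure.variationPow (ν : SigmaFiniteComplexMeasure S) (n : ℕ) :
    Measure (Fin n → S) :=
  Measure.pi fun _ => ν.variation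

/-- The phase of the complex product measure: `ν(dx₁) ⋯ ν(dxₙ) = phasePow(x) |ν|(dx₁) ⋯ |ν|(dxₙ)`. -/
def SigmaFiniteComplexMeasure.phasePow (ν : SigmaFiniteComplexMeasure S) {n : ℕ}
    (x : Fin n → S) : ℂ :=
  ∏ i, ν.phase (x i)

/-- The cube `Λⁿ ⊆ Sⁿ`. -/
def cube (Λ : Set S) (n : ℕ) : Set (Fin n → S) :=
  Set.univ.pi fun _ => Λ

/-- `ω_n(x₁,…,xₙ) = ∏_{i<j} w(x_i,x_j)`. -/
def weight (w : S → S → ℂ) {n : ℕ} (x : Fin n → S) : ℂ :=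
  ∏ p : Fin n × Fin n with p.1 < p.2, w (x p.1) (x p.2)

open Classical in
/-- The truncated weight `ω^T_n(x₁,…,xₙ) = ∑_G ∏_{{i,j} ∈ E(G)} (w(x_i,x_j) - 1)`, where `G` ranges
over the connected graphs with vertex set `{1,…,n}`. For `n = 1` the only such graph has no edge,
and the value is `1`. -/
def truncatedWeight (w : S → S → ℂ) {n : ℕ} (x : Fin n → S) : ℂ :=
  ∑ G : SimpleGraph (Fin n) with G.Connected,
    ∏ p : Fin n × Fin n with p.1 < p.2 ∧ G.Adj p.1 p.2, (w (x p.1) (x p.2) - 1)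

/-- `φ_n(x; y₁,…,yₙ) = ∏_i |w(x,y_i) - 1| ∏_{i<j} |w(y_i,y_j)|`. -/
def vertexWeight (w : S → S → ℂ) {n : ℕ} (x : S) (y : Fin n → S) : ℝ≥0∞ :=
  (∏ i, ‖w x (y i) - 1‖ₑ) * ∏ p : Fin n × Fin n with p.1 < p.2, ‖w (y p.1) (y p.2)‖ₑ

/-- The map `Ψ`:
`Ψ(μ)(x) = 1 + ∑_{n ≥ 1} (1/n!) ∫_{Sⁿ} φ_n(x; y) μ(y₁) ⋯ μ(yₙ) |ν|(dy₁) ⋯ |ν|(dyₙ)`. -/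
def vertexSum (w : S → S → ℂ) (ν : SigmaFiniteComplexMeasure S) (μ : S → ℝ≥0∞) (x : S) : ℝ≥0∞ :=
  1 + ∑' k : ℕ, (((k + 1)! : ℕ) : ℝ≥0∞)⁻¹ *
    ∫⁻ y : Fin (k + 1) → S, vertexWeight w x y * ∏ i, μ (y i) ∂ν.variationPow (k + 1)

/-- The density with respect to `|ν|ⁿ` of the `n`-th integral of the pinned expansion at `x`. -/
def pinnedIntegrand (w : S → S → ℂ) (ν : SigmaFiniteComplexMeasure S) (x : S) (n : ℕ)
    (y : Fin n → S) : ℂ :=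
  truncatedWeight w (Fin.cons x y : Fin (n + 1) → S) * ν.phasePow y

/-- The `n`-th term `(1/n!) ∫_{Sⁿ} ω^T_{n+1}(x, y₁,…,yₙ) ν(dy₁) ⋯ ν(dyₙ)` of the pinned expansion;
for `n = 0` it is `ω^T_1(x) = 1`. -/
def pinnedTerm (w : S → S → ℂ) (ν : SigmaFiniteComplexMeasure S) (x : S) (n : ℕ) : ℂ :=
  ((n ! : ℕ) : ℂ)⁻¹ * ∫ y, pinnedIntegrand w ν x n y ∂ν.variationPow n

/-- The pinned cluster expansion `Γ(ν)(x)`. -/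
def pinned (w : S → S → ℂ) (ν : SigmaFiniteComplexMeasure S) (x : S) : ℂ :=
  ∑' n : ℕ, pinnedTerm w ν x n

/-- The absolute pinned cluster expansion
`|Γ|(ν)(x) = ∑_{n ≥ 0} (1/n!) ∫_{Sⁿ} |ω^T_{n+1}(x, y₁,…,yₙ)| |ν|(dy₁) ⋯ |ν|(dyₙ)`. -/
def absPinned (w : S → S → ℂ) (ν : SigmaFiniteComplexMeasure S) (x : S) : ℝ≥0∞ :=
  ∑' n : ℕ, ((n ! : ℕ) : ℝ≥0∞)⁻¹ *
    ∫⁻ y : Fin n → S, ‖truncatedWeight w (Fin.cons x y : Fin (n + 1) → S)‖ₑ ∂ν.variationPow n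

/-- `Ξ_Λ(zν) = 1 + ∑_{n ≥ 1} (zⁿ/n!) ∫_{Λⁿ} ω_n(x₁,…,xₙ) ν(dx₁) ⋯ ν(dxₙ)`;
for `z = 1` this is the partition function `Ξ_Λ(ν)`. -/
def partitionFunction (w : S → S → ℂ) (ν : SigmaFiniteComplexMeasure S) (Λ : Set S) (z : ℂ) : ℂ :=
  1 + ∑' k : ℕ, z ^ (k + 1) / (((k + 1)! : ℕ) : ℂ) *
    ∫ x in cube Λ (k + 1), weight w x * ν.phasePow x ∂ν.variationPow (k + 1)

/-- `ℓ = ln Ξ_Λ(ν)`: the value at `z = 1` of the continuous branch of `z ↦ ln Ξ_Λ(zν)` on the closed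
unit disc that vanishes at `z = 0`. Such a branch exists iff `Ξ_Λ(zν)` has no zero on the disc, and
it is unique. -/
def IsLogPartitionFunction (w : S → S → ℂ) (ν : SigmaFiniteComplexMeasure S) (Λ : Set S) (ℓ : ℂ) :
    Prop :=
  ∃ F : ℂ → ℂ, ContinuousOn F (Metric.closedBall 0 1) ∧ F 0 = 0 ∧
    (∀ z ∈ Metric.closedBall (0 : ℂ) 1, Complex.exp (F z) = partitionFunction w ν Λ z) ∧ F 1 = ℓ

/-- The density with respect to `|ν|ⁿ` of the `n`-th integral of the cluster expansion. -/
def clusterIntegrand (w : S → S → ℂ) (ν : SigmaFiniteComplexMeasure S) (n : ℕ)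
    (x : Fin n → S) : ℂ :=
  truncatedWeight w x * ν.phasePow x

/-- The term `(1/n!) ∫_{Λⁿ} ω^T_n(x₁,…,xₙ) ν(dx₁) ⋯ ν(dxₙ)` of the cluster expansion. -/
def clusterTerm (w : S → S → ℂ) (ν : SigmaFiniteComplexMeasure S) (Λ : Set S) (n : ℕ) : ℂ :=
  ((n ! : ℕ) : ℂ)⁻¹ * ∫ x in cube Λ n, clusterIntegrand w ν n x ∂ν.variationPow n

/-- The absolute cluster expansion
`∑_{n ≥ 1} (1/n!) ∫_{Λⁿ} |ω^T_n(x₁,…,xₙ)| |ν|(dx₁) ⋯ |ν|(dxₙ)`. -/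
def absCluster (w : S → S → ℂ) (ν : SigmaFiniteComplexMeasure S) (Λ : Set S) : ℝ≥0∞ :=
  ∑' k : ℕ, (((k + 1)! : ℕ) : ℝ≥0∞)⁻¹ *
    ∫⁻ x in cube Λ (k + 1), ‖truncatedWeight w x‖ₑ ∂ν.variationPow (k + 1)

end PinnedCluster

end

open MeasureTheory
open scoped ENNReal Nat

noncomputable section

namespace PinnedCluster

/-! ### Sums over the splittings of a list -/

section ListAlgebra

variable {S : Type*} {R : Type*}

/-! The argument is algebraic at its core. Functions of finite lists form a commutative algebra
under convolution over splittings, and `f ↦ f (x :: ·)` is a derivation `D_x`. Write `ω` for the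
weights, `τ` for the truncated weights and `γ_x = D_x τ`. Grouping all graphs on `x :: l` by the
component of the root gives `D_x ω = γ_x * ω` (`conv_listTrunc`), so `γ_x * ω` is `ω` times the
multiplicative function `∏ w x y`.

Expand that product into sums over sublists `N` of `∏ (w x y - 1)`. Multiplication by a
multiplicative function respects convolution, so the interaction of the rest `M` with `N` can be
produced by convolving the functions `γ_a`, `a ∈ N`, damped by factors `w`. Cancelling `ω` yields a
recursion of `γ_x` over the neighbours `N` of the root (`eq_splitSum_dampedProd`). Since `|w| ≤ 1`,
absolute values remove the damping. With the weights `1/n!`, integration turns convolutions into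
products, and truncation at list length gives `|Γ|_{m+1} ≤ Ψ(|Γ|_m)` (`pinnedSum_succ_le`). As
`|Γ|_0 = 0` and `Ψ` is monotone, induction gives `|Γ| ≤ μ`.

In a region, a cluster has some point, and `n / n! = 1 / (n-1)!`; pinning at that point bounds the
absolute cluster expansion by `∫_Λ |Γ|`. This integral may be infinite although `μ < ∞` almost
everywhere. Finiteness comes from splitting `Λ` into the part where `|Γ| ≤ R` and a remainder of
small measure: clusters that touch the first are controlled by pinning, while on the second the
constant `2` is a supersolution for the restricted measure (`absCluster_lt_top`).

Finally, integrating `D_x ω = D_x τ * ω` with phases says that the cluster series `F(z)` and `Ξ(z)`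
satisfy `Ξ' = F' Ξ` coefficientwise. Hence `Ξ exp(-F) = 1` on the open disc, and by continuity `exp
F = Ξ` on the closed disc (`exp_tsum_mul_pow`). -/

/-- The sum of `K a b` over all ways of splitting a list into two complementary sublists. -/
def splitSum [AddCommMonoid R] : List S → (List S → List S → R) → R
  | [], K => K [] []
  | y :: l, K => splitSum l (fun a b => K (y :: a) b) + splitSum l (fun a b => K a (y :: b))

/-- The convolution of two functions of lists. -/
def conv [CommSemiring R] (f g : List S → R) (l : List S) : R :=
  splitSum l fun a b => f a * g b

/-- The unit of the convolution. -/
def convOne [CommSemiring R] : List S → R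
  | [] => 1
  | _ :: _ => 0

theorem splitSum_congr [AddCommMonoid R] (l : List S) :
    ∀ {K K' : List S → List S → R}, (∀ a b, (a ++ b).Perm l → K a b = K' a b) →
      splitSum l K = splitSum l K' := by
  induction l with
  | nil => intro K K' h; exact h [] [] (List.Perm.refl _)
  | cons y l ih =>
    intro K K' h
    simp only [splitSum]
    congr 1
    · exact ih fun a b hab => h _ _ (hab.cons y)
    · exact ih fun a b hab => h _ _ (List.perm_middle.trans (hab.cons y))

theorem splitSum_add [AddCommMonoid R] (l : List S) :
    ∀ K K' : List S → List S → R,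
      splitSum l (fun a b => K a b + K' a b) = splitSum l K + splitSum l K' := by
  induction l with
  | nil => intro K K'; rfl
  | cons y l ih =>
    intro K K'
    simp only [splitSum, ih]
    exact add_add_add_comm _ _ _ _

theorem splitSum_const_mul [CommSemiring R] (l : List S) (c : R) :
    ∀ K : List S → List S → R, splitSum l (fun a b => c * K a b) = c * splitSum l K := by
  induction l with
  | nil => intro K; rfl
  | cons y l ih => intro K; simp only [splitSum, ih, mul_add]

theorem splitSum_zero [AddCommMonoid R] (l : List S) :
    splitSum l (fun _ _ => (0 : R)) = 0 := by
  induction l with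
  | nil => rfl
  | cons y l ih => simp only [splitSum, ih, add_zero]

theorem splitSum_mono (l : List S) :
    ∀ {K K' : List S → List S → ℝ≥0∞}, (∀ a b, K a b ≤ K' a b) → splitSum l K ≤ splitSum l K' := by
  induction l with
  | nil => intro K K' h; exact h _ _
  | cons y l ih =>
    intro K K' h
    exact add_le_add (ih fun a b => h _ _) (ih fun a b => h _ _)

theorem enorm_splitSum_le (l : List S) :
    ∀ K : List S → List S → ℂ, ‖splitSum l K‖ₑ ≤ splitSum l fun a b => ‖K a b‖ₑ := by
  induction l with
  | nil => intro K; exact le_rfl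
  | cons y l ih =>
    intro K
    exact (enorm_add_le _ _).trans (add_le_add (ih _) (ih _))

/-- The convolution satisfies the Leibniz rule for the derivations `f ↦ f (x :: ·)`. -/
theorem conv_cons [CommSemiring R] (f g : List S → R) (x : S) (l : List S) :
    conv f g (x :: l) = conv (fun a => f (x :: a)) g l + conv f (fun b => g (x :: b)) l := rfl

theorem conv_add_left [CommSemiring R] (f f' g : List S → R) (l : List S) :
    conv (fun a => f a + f' a) g l = conv f g l + conv f' g l := by
  simp only [conv, add_mul, splitSum_add]

/-- Associativity of the convolution with a family of functions. -/
theorem conv_splitSum [CommSemiring R] (l : List S) :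
    ∀ (K : List S → List S → R) (f : List S → R),
      conv (fun c => splitSum c K) f l = splitSum l fun a b => conv (K a) f b := by
  induction l with
  | nil => intro K f; rfl
  | cons y l ih =>
    intro K f
    have h : (fun c => splitSum (y :: c) K) = fun c =>
        splitSum c (fun a b => K (y :: a) b) + splitSum c (fun a b => K a (y :: b)) := rfl
    rw [conv_cons, h, conv_add_left, ih, ih, ih]
    simp only [splitSum, conv_cons, splitSum_add]
    exact add_assoc _ _ _

theorem conv_const_mul_left [CommSemiring R] (c : R) (f g : List S → R) (l : List S) :
    conv (fun a => c * f a) g l = c * conv f g l := by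
  simp only [conv, mul_assoc, splitSum_const_mul]

theorem conv_assoc [CommSemiring R] (f g h : List S → R) (l : List S) :
    conv (conv f g) h l = conv f (conv g h) l := by
  refine (conv_splitSum l (fun a b => f a * g b) h).trans ?_
  simp only [conv_const_mul_left]
  rfl

theorem convOne_conv [CommSemiring R] (f : List S → R) (l : List S) :
    conv convOne f l = f l := by
  induction l generalizing f with
  | nil => simp [conv, splitSum, convOne]
  | cons y l ih =>
    rw [conv_cons, ih]
    have : conv (fun a : List S => convOne (y :: a)) f l = 0 := by
      simp only [conv, convOne, zero_mul, splitSum_zero]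
    rw [this, zero_add]

/-- Convolution with a function that is one on the empty list is injective. -/
theorem conv_right_cancel [CommRing R] {f g k : List S → R} (hk : k [] = 1)
    (h : ∀ l, conv f k l = conv g k l) (l : List S) : f l = g l := by
  have key : ∀ n : ℕ, ∀ d : List S → R, (∀ l : List S, l.length ≤ n → conv d k l = 0) →
      ∀ l : List S, l.length ≤ n → d l = 0 := by
    intro n
    induction n with
    | zero =>
      intro d hd l hl
      obtain rfl : l = [] := List.length_eq_zero_iff.1 (Nat.le_zero.1 hl)
      simpa [conv, splitSum, hk] using hd [] le_rfl
    | succ n ih =>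
      intro d hd
      have h1 : ∀ l : List S, l.length ≤ n → d l = 0 :=
        ih d fun l hl => hd l (hl.trans n.le_succ)
      intro l hl
      cases l with
      | nil => exact h1 [] (Nat.zero_le _)
      | cons x l =>
        -- By Leibniz, `d(x :: ·) * k` differs from the derivative of `d * k` by a term that
        -- involves `d` only on lists of length at most `n`, where `h1` makes it vanish.
        refine ih (fun a => d (x :: a)) (fun l hl => ?_) l (by simpa using hl)
        have h2 := hd (x :: l) (by simpa using hl)
        rw [conv_cons] at h2
        have h3 : conv d (fun b => k (x :: b)) l = 0 := by
          unfold conv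
          rw [← splitSum_zero (R := R) l]
          refine splitSum_congr l fun a b hab => ?_
          have := hab.length_eq
          rw [h1 a (by simp at this; omega), zero_mul]
        rwa [h3, add_zero] at h2
  have h0 : ∀ l, conv (fun a => f a + (-1) * g a) k l = 0 := by
    intro l
    rw [conv_add_left, conv_const_mul_left, h l]
    ring
  have := key l.length _ (fun l _ => h0 l) l le_rfl
  linear_combination this

/-- The multiplicative function of lists `l ↦ ∏_{y ∈ l} f y`. -/
def listProd [CommMonoid R] (f : S → R) (l : List S) : R := (l.map f).prod

@[simp] theorem listProd_nil [CommMonoid R] (f : S → R) : listProd f [] = 1 := rfl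

@[simp] theorem listProd_cons [CommMonoid R] (f : S → R) (x : S) (l : List S) :
    listProd f (x :: l) = f x * listProd f l := by simp [listProd]

theorem listProd_append [CommMonoid R] (f : S → R) (a b : List S) :
    listProd f (a ++ b) = listProd f a * listProd f b := by simp [listProd]

theorem listProd_perm [CommMonoid R] (f : S → R) {a b : List S} (h : a.Perm b) :
    listProd f a = listProd f b := (h.map f).prod_eq

theorem listProd_mul [CommMonoid R] (f g : S → R) (l : List S) :
    listProd (fun y => f y * g y) l = listProd f l * listProd g l := by
  simp [listProd, List.prod_map_mul]

theorem listProd_one [CommMonoid R] (l : List S) :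
    listProd (fun _ : S => (1 : R)) l = 1 := by simp [listProd]

/-- Multiplication by a multiplicative function is a homomorphism for the convolution. -/
theorem conv_listProd_mul [CommSemiring R] (c : S → R) (f g : List S → R) (l : List S) :
    conv (fun a => listProd c a * f a) (fun b => listProd c b * g b) l =
      listProd c l * conv f g l := by
  unfold conv
  rw [← splitSum_const_mul]
  refine splitSum_congr l fun a b hab => ?_
  rw [← listProd_perm c hab, listProd_append]
  ring

/-- With `c = w x · - 1` this is the Mayer expansion of `∏ w x y`; the first sublist collects the
neighbours of the root. -/
theorem splitSum_listProd [CommSemiring R] (c : S → R) (l : List S) :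
    splitSum l (fun a _ => listProd c a) = listProd (fun y => c y + 1) l := by
  induction l with
  | nil => rfl
  | cons y l ih => simp only [splitSum, listProd_cons, splitSum_const_mul, ih, add_mul, one_mul]

/-! ### Weights of lists -/

/-- The product of `w` over all pairs of entries of a list. -/
def listWeight (w : S → S → ℂ) : List S → ℂ
  | [] => 1
  | x :: l => listProd (w x) l * listWeight w l

/-- The interaction `∏_{x ∈ a} w x y` of a point with a list. -/
def crossWeight (w : S → S → ℂ) (a : List S) (y : S) : ℂ := listProd (fun x => w x y) a

theorem listWeight_append {w : S → S → ℂ} (a b : List S) :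
    listWeight w (a ++ b) =
      listWeight w a * (listProd (crossWeight w a) b * listWeight w b) := by
  induction a with
  | nil =>
    have : crossWeight w [] = fun _ => 1 := rfl
    simp [listWeight, this, listProd_one]
  | cons x a ih =>
    have : crossWeight w (x :: a) = fun y => w x y * crossWeight w a y := by
      funext y; simp [crossWeight]
    rw [List.cons_append, listWeight, ih, this, listProd_mul, listProd_append, listWeight]
    ring

theorem listWeight_perm {w : S → S → ℂ} (hw : ∀ x y, w x y = w y x) {a b : List S}
    (h : a.Perm b) : listWeight w a = listWeight w b := by
  induction h with
  | nil => rfl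
  | cons x h ih => simp only [listWeight, ih, listProd_perm _ h]
  | swap x y l => simp only [listWeight, listProd_cons, hw x y]; ring
  | trans _ _ ih ih' => exact ih.trans ih'

/-- For a family `γ` of functions of lists, the convolution of the functions `γ a`, each damped by
the interaction with the subsequent roots. -/
def dampedProd (w : S → S → ℂ) (γ : S → List S → ℂ) : List S → List S → ℂ
  | [] => convOne
  | a :: N => conv (fun l => listProd (crossWeight w N) l * γ a l) (dampedProd w γ N)

/-- Adding a root `a` convolves the damped `γ a` with a function that already carries the factor
`crossWeight w N`. This factor is multiplicative, so it comes out of the convolution, and the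
hypothesis on `γ a` supplies the missing factor `w a`. -/
theorem conv_dampedProd {w : S → S → ℂ} {γ : S → List S → ℂ}
    (hγ : ∀ x l, conv (γ x) (listWeight w) l = listProd (w x) l * listWeight w l)
    (N l : List S) :
    conv (dampedProd w γ N) (listWeight w) l = listProd (crossWeight w N) l * listWeight w l := by
  induction N generalizing l with
  | nil =>
    have : crossWeight w [] = fun _ => 1 := rfl
    simp [dampedProd, convOne_conv, this, listProd_one]
  | cons a N ih =>
    have : crossWeight w (a :: N) = fun y => crossWeight w N y * w a y := by
      funext y; simp [crossWeight, mul_comm]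
    rw [dampedProd, conv_assoc, funext ih, conv_listProd_mul, hγ, this, listProd_mul, mul_assoc]

/-- The decomposition of the pinned weight according to the neighbours of the root. -/
theorem eq_splitSum_dampedProd {w : S → S → ℂ} (hw : ∀ x y, w x y = w y x)
    {γ : S → List S → ℂ}
    (hγ : ∀ x l, conv (γ x) (listWeight w) l = listProd (w x) l * listWeight w l)
    (x : S) (l : List S) :
    γ x l = splitSum l fun N M =>
      listProd (fun y => w x y - 1) N * listWeight w N * dampedProd w γ N M := by
  refine conv_right_cancel (f := γ x) (g := fun l => splitSum l fun N M =>
    listProd (fun y => w x y - 1) N * listWeight w N * dampedProd w γ N M)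
    (k := listWeight w) rfl (fun l => ?_) l
  rw [hγ, conv_splitSum]
  simp only [conv_const_mul_left, conv_dampedProd hγ]
  -- Weight of `a`, interaction of `a` with `b` and weight of `b` recombine into the weight of `l`,
  -- so only the Mayer expansion over `a` remains.
  have : ∀ a b : List S, (a ++ b).Perm l →
      listProd (fun y => w x y - 1) a * listWeight w a *
        (listProd (crossWeight w a) b * listWeight w b) =
      listWeight w l * listProd (fun y => w x y - 1) a := by
    intro a b hab
    rw [← listWeight_perm hw hab, listWeight_append]
    ring
  rw [splitSum_congr l this, splitSum_const_mul, splitSum_listProd]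
  simp only [sub_add_cancel]
  exact mul_comm _ _

/-- The iterated convolution of the functions `|γ a|`, `a ∈ N`. -/
def absProd (γ : S → List S → ℂ) : List S → List S → ℝ≥0∞
  | [] => convOne
  | a :: N => conv (fun l => ‖γ a l‖ₑ) (absProd γ N)

theorem enorm_listProd_le_one {c : S → ℂ} (hc : ∀ y, ‖c y‖ₑ ≤ 1) (l : List S) :
    ‖listProd c l‖ₑ ≤ 1 := by
  induction l with
  | nil => simp
  | cons x l ih =>
    rw [listProd_cons, enorm_mul]
    exact mul_le_one' (hc x) ih

theorem enorm_listProd (c : S → ℂ) (l : List S) :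
    ‖listProd c l‖ₑ = listProd (fun y => ‖c y‖ₑ) l := by
  induction l with
  | nil => simp
  | cons x l ih => rw [listProd_cons, listProd_cons, enorm_mul, ih]

theorem enorm_conv_le (f g : List S → ℂ) (l : List S) :
    ‖conv f g l‖ₑ ≤ conv (fun a => ‖f a‖ₑ) (fun b => ‖g b‖ₑ) l := by
  refine (enorm_splitSum_le _ _).trans (le_of_eq ?_)
  simp only [enorm_mul, conv]

theorem conv_mono {f f' g g' : List S → ℝ≥0∞} (hf : ∀ l, f l ≤ f' l) (hg : ∀ l, g l ≤ g' l)
    (l : List S) : conv f g l ≤ conv f' g' l :=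
  splitSum_mono l fun a b => mul_le_mul' (hf a) (hg b)

/-- The damping factors are products of values of `w`; this is where `|w| ≤ 1` enters the pinned
bound. -/
theorem enorm_dampedProd_le {w : S → S → ℂ} (hw : ∀ x y, ‖w x y‖ₑ ≤ 1) (γ : S → List S → ℂ)
    (N l : List S) : ‖dampedProd w γ N l‖ₑ ≤ absProd γ N l := by
  induction N generalizing l with
  | nil => cases l <;> simp [dampedProd, absProd, convOne]
  | cons a N ih =>
    refine (enorm_conv_le _ _ l).trans (conv_mono (fun l => ?_) ih l)
    rw [enorm_mul]
    exact mul_le_of_le_one_left' (enorm_listProd_le_one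
      (fun y => enorm_listProd_le_one (fun x => hw x y) N) l)

theorem enorm_le_splitSum_absProd {w : S → S → ℂ} (hw : ∀ x y, w x y = w y x)
    (hw1 : ∀ x y, ‖w x y‖ₑ ≤ 1) {γ : S → List S → ℂ}
    (hγ : ∀ x l, conv (γ x) (listWeight w) l = listProd (w x) l * listWeight w l)
    (x : S) (l : List S) :
    ‖γ x l‖ₑ ≤ splitSum l fun N M =>
      listProd (fun y => ‖w x y - 1‖ₑ) N * ‖listWeight w N‖ₑ * absProd γ N M := by
  rw [eq_splitSum_dampedProd hw hγ]
  refine (enorm_splitSum_le _ _).trans (splitSum_mono l fun N M => ?_)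
  rw [enorm_mul, enorm_mul, enorm_listProd]
  exact mul_le_mul' le_rfl (enorm_dampedProd_le hw1 γ N M)

end ListAlgebra

/-! ### Sums over graphs -/

section Graphs

open Classical in
/-- The product of the edge weights of a graph. -/
def edgeProd {V : Type*} [Fintype V] (a : Sym2 V → ℂ) (G : SimpleGraph V) : ℂ :=
  ∏ s : Sym2 V with s ∈ G.edgeSet, a s

open Classical in
/-- The sum of the edge products of all graphs. -/
def graphSum {V : Type*} [Fintype V] (a : Sym2 V → ℂ) : ℂ :=
  ∑ G : SimpleGraph V, edgeProd a G

open Classical in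
/-- The sum of the edge products of all connected graphs. -/
def connSum {V : Type*} [Fintype V] (a : Sym2 V → ℂ) : ℂ :=
  ∑ G : SimpleGraph V with G.Connected, edgeProd a G

variable {V V' : Type*} [Fintype V] [Fintype V']

theorem edgeProd_comap (e : V ≃ V') (a : Sym2 V' → ℂ) (G : SimpleGraph V') :
    edgeProd (fun s => a (s.map e)) (G.comap e) = edgeProd a G := by
  classical
  unfold edgeProd
  refine Finset.prod_bij (fun s _ => s.map e) ?_ ?_ ?_ (fun _ _ => rfl)
  · intro s hs
    induction s with
    | _ i j => simpa using hs
  · intro s _ t _ h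
    exact Sym2.map.injective e.injective h
  · intro s hs
    refine ⟨s.map e.symm, ?_, by simp [Sym2.map_map]⟩
    induction s with
    | _ i j => simpa using hs

theorem graphSum_comp_equiv (e : V ≃ V') (a : Sym2 V' → ℂ) :
    graphSum (fun s => a (s.map e)) = graphSum a := by
  classical
  unfold graphSum
  refine (Finset.sum_equiv e.symm.simpleGraph (by simp) (fun G _ => ?_)).symm
  exact (edgeProd_comap e a G).symm

theorem connSum_comp_equiv (e : V ≃ V') (a : Sym2 V' → ℂ) :
    connSum (fun s => a (s.map e)) = connSum a := by
  classical
  unfold connSum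
  refine (Finset.sum_equiv e.symm.simpleGraph (fun G => ?_) (fun G _ => ?_)).symm
  · have : (e.symm.simpleGraph G) ≃g G := SimpleGraph.Iso.comap e G
    simp only [Finset.mem_filter, Finset.mem_univ, true_and, this.connected_iff]
  · exact (edgeProd_comap e a G).symm

-- Expanding the product selects a set of non-loop unordered pairs, which is the edge set of exactly
-- one graph.
open Classical in
theorem graphSum_eq_prod (a : Sym2 V → ℂ) :
    graphSum a = ∏ s : Sym2 V with s ∈ (⊤ : SimpleGraph V).edgeSet, (a s + 1) := by
  rw [Finset.prod_add_one]
  unfold graphSum edgeProd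
  refine Finset.sum_bij' (fun G _ => Finset.univ.filter fun s => s ∈ G.edgeSet)
    (fun t _ => SimpleGraph.fromEdgeSet (t : Set (Sym2 V))) ?_ ?_ ?_ ?_ ?_
  · intro G _
    rw [Finset.mem_powerset]
    intro s hs
    simp only [Finset.mem_filter, Finset.mem_univ, true_and] at hs ⊢
    exact SimpleGraph.edgeSet_mono le_top hs
  · intro t _; exact Finset.mem_univ _
  · intro G _; simp
  · intro t ht
    rw [Finset.mem_powerset] at ht
    ext s
    have := @ht s
    simp only [Finset.mem_filter, Finset.mem_univ, true_and, SimpleGraph.edgeSet_top,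
      SimpleGraph.edgeSet_fromEdgeSet] at this ⊢
    simp
    tauto
  · intro G _; rfl

theorem prod_lt_adj_eq_edgeProd {V : Type*} [Fintype V] [LinearOrder V] (a : Sym2 V → ℂ)
    (G : SimpleGraph V) [DecidablePred fun p : V × V => p.1 < p.2 ∧ G.Adj p.1 p.2] :
    ∏ p : V × V with p.1 < p.2 ∧ G.Adj p.1 p.2, a s(p.1, p.2) = edgeProd a G := by
  classical
  unfold edgeProd
  refine Finset.prod_bij (fun p _ => s(p.1, p.2)) ?_ ?_ ?_ (fun _ _ => rfl)
  · intro p hp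
    simp only [Finset.mem_filter, Finset.mem_univ, true_and] at hp ⊢
    exact hp.2
  · rintro ⟨i, j⟩ hp ⟨i', j'⟩ hq h
    simp only [Finset.mem_filter, Finset.mem_univ, true_and] at hp hq
    rcases Sym2.eq_iff.1 h with ⟨rfl, rfl⟩ | ⟨rfl, rfl⟩
    · rfl
    · exact absurd hp.1 hq.1.asymm
  · intro s hs
    induction s with
    | _ i j =>
      simp only [Finset.mem_filter, Finset.mem_univ, true_and, SimpleGraph.mem_edgeSet] at hs
      rcases lt_or_gt_of_ne hs.ne with h | h
      · exact ⟨(i, j), by simp [h, hs], rfl⟩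
      · exact ⟨(j, i), by simp [h, hs.symm], Sym2.eq_swap⟩

/-- The disjoint union of a graph on `A` and a graph on its complement. -/
def glue {V : Type*} (A : Finset V) (H : SimpleGraph {i // i ∈ A}) (K : SimpleGraph {i // i ∉ A}) :
    SimpleGraph V :=
  H.map (Function.Embedding.subtype _) ⊔ K.map (Function.Embedding.subtype _)

theorem glue_adj {V : Type*} {A : Finset V} {H : SimpleGraph {i // i ∈ A}}
    {K : SimpleGraph {i // i ∉ A}} {i j : V} :
    (glue A H K).Adj i j ↔ (∃ (hi : i ∈ A) (hj : j ∈ A), H.Adj ⟨i, hi⟩ ⟨j, hj⟩) ∨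
      ∃ (hi : i ∉ A) (hj : j ∉ A), K.Adj ⟨i, hi⟩ ⟨j, hj⟩ := by
  rw [glue, SimpleGraph.sup_adj, SimpleGraph.map_adj, SimpleGraph.map_adj]
  refine or_congr ⟨?_, ?_⟩ ⟨?_, ?_⟩
  · rintro ⟨u, v, h, rfl, rfl⟩
    exact ⟨u.2, v.2, h⟩
  · rintro ⟨hi, hj, h⟩
    exact ⟨_, _, h, rfl, rfl⟩
  · rintro ⟨u, v, h, rfl, rfl⟩
    exact ⟨u.2, v.2, h⟩
  · rintro ⟨hi, hj, h⟩
    exact ⟨_, _, h, rfl, rfl⟩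

theorem edgeProd_glue (a : Sym2 V → ℂ) (A : Finset V) [DecidableEq V]
    (H : SimpleGraph {i // i ∈ A}) (K : SimpleGraph {i // i ∉ A}) :
    edgeProd a (glue A H K) =
      edgeProd (fun s => a (s.map Subtype.val)) H * edgeProd (fun s => a (s.map Subtype.val)) K := by
  classical
  have hH : (Finset.univ.filter fun s => s ∈ (glue A H K).edgeSet) =
      (Finset.univ.filter fun s => s ∈ H.edgeSet).image (Sym2.map Subtype.val) ∪
      (Finset.univ.filter fun s => s ∈ K.edgeSet).image (Sym2.map Subtype.val) := by
    ext s
    simp only [glue, SimpleGraph.edgeSet_sup, SimpleGraph.edgeSet_map, Finset.mem_filter,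
      Finset.mem_univ, true_and, Finset.mem_union, Finset.mem_image, Set.mem_union, Set.mem_image]
    rfl
  unfold edgeProd
  rw [hH, Finset.prod_union, Finset.prod_image, Finset.prod_image]
  · exact (Sym2.map.injective Subtype.val_injective).injOn
  · exact (Sym2.map.injective Subtype.val_injective).injOn
  · rw [Finset.disjoint_left]
    intro s hs hs'
    simp only [Finset.mem_image] at hs hs'
    obtain ⟨t, -, rfl⟩ := hs
    obtain ⟨t', -, h⟩ := hs'
    induction t with
    | _ i j =>
      induction t' with
      | _ i' j' =>
        have : (i : V) ∈ (s((i' : V), (j' : V)) : Sym2 V) := by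
          have : (i : V) ∈ (s((i : V), (j : V)) : Sym2 V) := Sym2.mem_mk_left _ _
          rwa [← Sym2.map_mk, ← h] at this
        rcases Sym2.mem_iff.1 this with h | h
        · exact i'.2 (h ▸ i.2)
        · exact j'.2 (h ▸ i.2)

/-- No edge of the glued graph leaves `A`, and `H` connects all of `A`. -/
theorem reachable_glue {V : Type*} {A : Finset V} {H : SimpleGraph {i // i ∈ A}}
    {K : SimpleGraph {i // i ∉ A}} (hH : H.Connected) {v : V} (hv : v ∈ A) (u : V) :
    (glue A H K).Reachable v u ↔ u ∈ A := by
  constructor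
  · intro h
    rw [SimpleGraph.reachable_iff_reflTransGen] at h
    induction h with
    | refl => exact hv
    | tail _ h ih =>
      rcases glue_adj.1 h with ⟨_, hj, _⟩ | ⟨hi, _, _⟩
      · exact hj
      · exact absurd ih hi
  · intro hu
    let f : H →g glue A H K := ⟨Subtype.val, fun {i j} h => glue_adj.2 (Or.inl ⟨i.2, j.2, h⟩)⟩
    exact (hH.preconnected ⟨v, hv⟩ ⟨u, hu⟩).map f

/-- A path from `v` never leaves the component of `v`, so it is a path of the induced graph. -/
theorem comap_connected {V : Type*} {A : Finset V} {G : SimpleGraph V} {v : V}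
    (h : ∀ u, G.Reachable v u ↔ u ∈ A) :
    (G.comap (Subtype.val : {i // i ∈ A} → V)).Connected := by
  rw [SimpleGraph.connected_iff_exists_forall_reachable]
  refine ⟨⟨v, (h v).1 (SimpleGraph.Reachable.refl v)⟩, ?_⟩
  rintro ⟨u, hu⟩
  have hvu := (h u).2 hu
  rw [SimpleGraph.reachable_iff_reflTransGen] at hvu
  induction hvu with
  | refl => exact SimpleGraph.Reachable.refl _
  | @tail b c hb hbc ih =>
    have hbA : b ∈ A := (h b).1 ((SimpleGraph.reachable_iff_reflTransGen _ _).2 hb)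
    refine (ih hbA).trans (SimpleGraph.Adj.reachable ?_)
    exact hbc

/-- Every graph is the disjoint union of the component of `v` and a graph on the complement. -/
theorem graphSum_eq_sum_connSum (a : Sym2 V → ℂ) (v : V) [DecidableEq V] :
    graphSum a = ∑ A : Finset V with v ∈ A,
      connSum (fun s : Sym2 {i // i ∈ A} => a (s.map Subtype.val)) *
        graphSum (fun s : Sym2 {i // i ∉ A} => a (s.map Subtype.val)) := by
  classical
  unfold graphSum
  rw [← Finset.sum_fiberwise_of_maps_to
    (g := fun G : SimpleGraph V => Finset.univ.filter fun u => G.Reachable v u)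
    (t := Finset.univ.filter fun A : Finset V => v ∈ A) (fun G _ => by simp)]
  refine Finset.sum_congr rfl fun A hA => ?_
  have hv : v ∈ A := by simpa using hA
  unfold connSum
  rw [Finset.sum_mul_sum, ← Finset.sum_product']
  have hmem : ∀ G : SimpleGraph V, (Finset.univ.filter fun u => G.Reachable v u) = A ↔
      ∀ u, G.Reachable v u ↔ u ∈ A := by
    intro G
    rw [Finset.ext_iff]
    simp
  -- A graph has no edge between the component of `v` and its complement, so its two restrictions
  -- determine it.
  have hglue : ∀ G : SimpleGraph V, (∀ u, G.Reachable v u ↔ u ∈ A) →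
      glue A (G.comap Subtype.val) (G.comap Subtype.val) = G := by
    intro G hG
    ext i j
    rw [glue_adj]
    constructor
    · rintro (⟨_, _, h⟩ | ⟨_, _, h⟩) <;> exact h
    · intro h
      by_cases hi : i ∈ A
      · exact Or.inl ⟨hi, (hG j).1 (((hG i).2 hi).trans h.reachable), h⟩
      · exact Or.inr ⟨hi, fun hj => hi ((hG i).1 (((hG j).2 hj).trans h.symm.reachable)), h⟩
  refine Finset.sum_bij'
    (fun G _ => (G.comap (Subtype.val : {i // i ∈ A} → V), G.comap (Subtype.val : {i // i ∉ A} → V)))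
    (fun P _ => glue A P.1 P.2) ?_ ?_ ?_ ?_ ?_
  · intro G hG
    simp only [Finset.mem_filter, Finset.mem_univ, true_and, hmem] at hG
    simp only [Finset.mem_product, Finset.mem_filter, Finset.mem_univ, true_and, and_true]
    exact comap_connected hG
  · intro P hP
    simp only [Finset.mem_product, Finset.mem_filter, Finset.mem_univ, true_and, and_true] at hP
    simp only [Finset.mem_filter, Finset.mem_univ, true_and, hmem]
    exact reachable_glue hP hv
  · intro G hG
    simp only [Finset.mem_filter, Finset.mem_univ, true_and, hmem] at hG
    exact hglue G hG
  · rintro ⟨H, K⟩ hP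
    ext i j
    · simp [glue_adj]
    · simp [glue_adj, i.2, j.2]
  · intro G hG
    simp only [Finset.mem_filter, Finset.mem_univ, true_and, hmem] at hG
    rw [← edgeProd_glue a A, hglue G hG]

end Graphs

/-! ### Truncated weights of lists -/

section ListWeights

variable {S : Type*}

/-- Splittings are indexed by sets of positions rather than of entries, so repeated entries stay
distinguishable. -/
theorem splitSum_map {ι R : Type*} [DecidableEq ι] [AddCommMonoid R] (y : ι → S) (L : List ι)
    (hL : L.Nodup) : ∀ K : List S → List S → R,
      splitSum (L.map y) K = ∑ B ∈ L.toFinset.powerset,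
        K ((L.filter (· ∈ B)).map y) ((L.filter (· ∉ B)).map y) := by
  induction L with
  | nil => intro K; simp [splitSum]
  | cons i L ih =>
    intro K
    obtain ⟨hi, hL'⟩ := List.nodup_cons.1 hL
    have hi' : i ∉ L.toFinset := by simpa using hi
    rw [List.map_cons, splitSum, ih hL', ih hL', List.toFinset_cons,
      Finset.sum_powerset_insert hi', add_comm]
    congr 1
    · refine Finset.sum_congr rfl fun B hB => ?_
      have hiB : i ∉ B := fun h => hi' (Finset.mem_powerset.1 hB h)
      simp [hiB]
    · refine Finset.sum_congr rfl fun B hB => ?_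
      have h1 : L.filter (· ∈ insert i B) = L.filter (· ∈ B) := by
        refine List.filter_congr fun j hj => ?_
        have : j ≠ i := fun h => hi (h ▸ hj)
        simp [this]
      have h2 : L.filter (· ∉ insert i B) = L.filter (· ∉ B) := by
        refine List.filter_congr fun j hj => ?_
        have : j ≠ i := fun h => hi (h ▸ hj)
        simp [this]
      rw [List.filter_cons_of_pos (by simp), List.filter_cons_of_neg (by simp), h1, h2]
      rfl

/-- The edge weight `w - 1` as a function of unordered pairs. -/
def edgeWeight (w : S → S → ℂ) (hw : ∀ x y, w x y = w y x) : Sym2 S → ℂ :=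
  Sym2.lift ⟨fun x y => w x y - 1, fun x y => by simp only [hw x y]⟩

theorem truncatedWeight_eq_connSum {w : S → S → ℂ} (hw : ∀ x y, w x y = w y x) {n : ℕ}
    (y : Fin n → S) : truncatedWeight w y = connSum fun s => edgeWeight w hw (s.map y) := by
  classical
  unfold truncatedWeight connSum
  refine Finset.sum_congr (by ext; simp) fun G _ => ?_
  rw [← prod_lt_adj_eq_edgeProd]
  refine Finset.prod_congr (by ext; simp) fun p _ => ?_
  rfl

theorem weight_eq_graphSum {w : S → S → ℂ} (hw : ∀ x y, w x y = w y x) {n : ℕ}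
    (y : Fin n → S) : weight w y = graphSum fun s => edgeWeight w hw (s.map y) := by
  classical
  rw [graphSum_eq_prod]
  have := prod_lt_adj_eq_edgeProd (fun s => edgeWeight w hw (s.map y) + 1)
    (⊤ : SimpleGraph (Fin n))
  rw [edgeProd] at this
  refine Eq.trans ?_ (this.trans (Finset.prod_congr (by ext; simp) fun _ _ => rfl))
  rw [weight]
  refine Finset.prod_congr ?_ fun p _ => ?_
  · ext p
    simpa using fun h => ne_of_lt h
  · simp [edgeWeight]

theorem connSum_edgeWeight_congr {ι ι' : Type*} [Fintype ι] [Fintype ι'] {w : S → S → ℂ}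
    (hw : ∀ x y, w x y = w y x) (e : ι ≃ ι') {y : ι → S} {y' : ι' → S} (h : ∀ i, y i = y' (e i)) :
    (connSum fun s => edgeWeight w hw (s.map y)) = connSum fun s => edgeWeight w hw (s.map y') := by
  rw [← connSum_comp_equiv e]
  have : y = y' ∘ e := funext h
  simp only [this, Sym2.map_map]

theorem graphSum_edgeWeight_congr {ι ι' : Type*} [Fintype ι] [Fintype ι'] {w : S → S → ℂ}
    (hw : ∀ x y, w x y = w y x) (e : ι ≃ ι') {y : ι → S} {y' : ι' → S} (h : ∀ i, y i = y' (e i)) :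
    (graphSum fun s => edgeWeight w hw (s.map y)) =
      graphSum fun s => edgeWeight w hw (s.map y') := by
  rw [← graphSum_comp_equiv e]
  have : y = y' ∘ e := funext h
  simp only [this, Sym2.map_map]

/-- The truncated weight of the entries of a list. -/
def listTrunc (w : S → S → ℂ) (l : List S) : ℂ := truncatedWeight w l.get

theorem listTrunc_ofFn (w : S → S → ℂ) {n : ℕ} (y : Fin n → S) :
    listTrunc w (List.ofFn y) = truncatedWeight w y := by
  have key : ∀ (l : List S) (h : l.length = n), (∀ i : Fin n, l.get (Fin.cast h.symm i) = y i) →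
      truncatedWeight w l.get = truncatedWeight w y := by
    intro l h hl
    subst h
    congr 1
    funext i
    exact hl i
  exact key _ List.length_ofFn (fun i => by simp)

theorem prod_pairs_succ {M : Type*} [CommMonoid M] {n : ℕ} (f : Fin (n + 1) → Fin (n + 1) → M) :
    ∏ p : Fin (n + 1) × Fin (n + 1) with p.1 < p.2, f p.1 p.2 =
      (∏ j : Fin n, f 0 j.succ) * ∏ p : Fin n × Fin n with p.1 < p.2, f p.1.succ p.2.succ := by
  simp only [Finset.prod_filter, Fintype.prod_prod_type, Fin.prod_univ_succ, Fin.succ_lt_succ_iff,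
    Fin.succ_pos, Fin.not_lt_zero, if_true, if_false, one_mul]

theorem listProd_ofFn {M : Type*} [CommMonoid M] (f : S → M) {n : ℕ} (y : Fin n → S) :
    listProd f (List.ofFn y) = ∏ i, f (y i) := by
  simp [listProd, List.map_ofFn, List.prod_ofFn]

theorem listWeight_ofFn (w : S → S → ℂ) {n : ℕ} (y : Fin n → S) :
    listWeight w (List.ofFn y) = weight w y := by
  induction n with
  | zero => simp [listWeight, weight]
  | succ n ih =>
    rw [List.ofFn_succ, listWeight, ih, listProd_ofFn, weight, weight,
      prod_pairs_succ fun i j => w (y i) (y j)]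

theorem listTrunc_map {ι : Type*} [DecidableEq ι] {w : S → S → ℂ} (hw : ∀ x y, w x y = w y x)
    (z : ι → S) {L : List ι} (hL : L.Nodup) :
    listTrunc w (L.map z) =
      connSum fun s : Sym2 {i // i ∈ L} => edgeWeight w hw (s.map fun i : {i // i ∈ L} => z i) := by
  rw [listTrunc, truncatedWeight_eq_connSum hw]
  refine connSum_edgeWeight_congr hw ((finCongr (List.length_map z)).trans (hL.getEquiv L)) ?_
  intro i
  simp

theorem listWeight_map {ι : Type*} [DecidableEq ι] {w : S → S → ℂ} (hw : ∀ x y, w x y = w y x)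
    (z : ι → S) {L : List ι} (hL : L.Nodup) :
    listWeight w (L.map z) =
      graphSum fun s : Sym2 {i // i ∈ L} => edgeWeight w hw (s.map fun i : {i // i ∈ L} => z i) := by
  have h : listWeight w (L.map z) = weight w (L.map z).get := by
    rw [← listWeight_ofFn, List.ofFn_get]
  rw [h, weight_eq_graphSum hw]
  refine graphSum_edgeWeight_congr hw ((finCongr (List.length_map z)).trans (hL.getEquiv L)) ?_
  intro i
  simp

theorem truncatedWeight_comp_equiv {w : S → S → ℂ} (hw : ∀ x y, w x y = w y x) {n : ℕ}
    (e : Fin n ≃ Fin n) (y : Fin n → S) :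
    truncatedWeight w (fun i => y (e i)) = truncatedWeight w y := by
  rw [truncatedWeight_eq_connSum hw, truncatedWeight_eq_connSum hw]
  exact connSum_edgeWeight_congr hw e fun _ => rfl

/-- The recursion that determines the truncated weights. -/
theorem conv_listTrunc {w : S → S → ℂ} (hw : ∀ x y, w x y = w y x) (x : S) (l : List S) :
    conv (fun a => listTrunc w (x :: a)) (listWeight w) l =
      listProd (w x) l * listWeight w l := by
  classical
  obtain ⟨n, y, rfl⟩ : ∃ (n : ℕ) (y : Fin n → S), l = (List.finRange n).map y :=
    ⟨l.length, l.get, by simp⟩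
  -- The root becomes the extra vertex `none`; the index lists are then free of duplicates even if
  -- `x` or entries of `y` coincide.
  set z : Option (Fin n) → S := fun o => o.elim x y with hz
  have hsome : ∀ L : List (Fin n), L.map y = (L.map some).map z := by
    intro L; simp [hz]
  have hnone : ∀ L : List (Fin n), x :: L.map y = (none :: L.map some).map z := by
    intro L; simp [hz]
  have hnd := List.nodup_finRange n
  change _ = listWeight w (x :: (List.finRange n).map y)
  have hL : (none :: (List.finRange n).map some : List (Option (Fin n))).Nodup := by
    simp [List.nodup_cons, List.nodup_map_iff (Option.some_injective _), hnd]
  rw [conv, splitSum_map _ _ hnd, hnone, listWeight_map hw z hL]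
  refine Eq.trans ?_ (graphSum_edgeWeight_congr hw (y' := z)
    (Equiv.subtypeUnivEquiv (by rintro (_ | i) <;> simp)) (fun i => rfl)).symm
  -- The component of the root is `insertNone B`, where `B` ranges over all subsets of the other
  -- vertices.
  rw [graphSum_eq_sum_connSum _ none]
  refine Finset.sum_bij' (fun B _ => Finset.insertNone B) (fun A _ => Finset.eraseNone A)
    ?_ ?_ ?_ ?_ ?_
  · intro B _; simp
  · intro A _; simp
  · intro B _; simp
  · intro A hA
    have : none ∈ A := by simpa using hA
    simp [this]
  · intro B _
    have h1 : (none :: ((List.finRange n).filter (· ∈ B)).map some : List (Option (Fin n))).Nodup := by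
      simp [List.nodup_cons, List.nodup_map_iff (Option.some_injective _), hnd.filter]
    have h2 : ((((List.finRange n).filter (· ∉ B)).map some : List (Option (Fin n)))).Nodup := by
      simp only [List.nodup_map_iff (Option.some_injective _), hnd.filter]
    rw [hnone, hsome, listTrunc_map hw z h1, listWeight_map hw z h2]
    simp only [Sym2.map_map]
    congr 1
    · refine connSum_edgeWeight_congr hw (Equiv.subtypeEquivRight ?_) (fun i => rfl)
      rintro (_ | i) <;> simp
    · refine graphSum_edgeWeight_congr hw (Equiv.subtypeEquivRight ?_) (fun i => rfl)
      rintro (_ | i) <;> simp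

end ListWeights

/-! ### Integration over lists -/

section ListIntegrals

variable {S : Type*} [MeasurableSpace S] {E : Type*} [MeasurableSpace E]

theorem measurable_fin_cons {n : ℕ} :
    Measurable fun q : S × (Fin n → S) => (Fin.cons q.1 q.2 : Fin (n + 1) → S) := by
  rw [measurable_pi_iff]
  intro i
  refine Fin.cases ?_ (fun j => ?_) i
  · exact measurable_fst
  · exact (measurable_pi_apply j).comp measurable_snd

theorem map_eq_ofFn {S : Type*} {n : ℕ} (L : List (Fin n)) (y : Fin n → S) :
    L.map y = List.ofFn fun i => y (L.get i) := by
  rw [← List.ofFn_get (L.map y)]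
  refine List.ext_get (by simp) fun i h h' => by simp

/-- A function of lists is measurable if its restrictions to lists of given length are. -/
def ListMeasurable (f : List S → E) : Prop :=
  ∀ n, Measurable fun y : Fin n → S => f (List.ofFn y)

/-- Joint measurability of a function of two lists. -/
def ListMeasurable₂ (K : List S → List S → E) : Prop :=
  ∀ m n, Measurable fun q : (Fin m → S) × (Fin n → S) => K (List.ofFn q.1) (List.ofFn q.2)

theorem measurable_comp_get {n : ℕ} (L : List (Fin n)) :
    Measurable fun (y : Fin n → S) i => y (L.get i) :=
  measurable_pi_lambda _ fun i => measurable_pi_apply (L.get i)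

theorem ListMeasurable.cons {f : List S → E} (hf : ListMeasurable f) (n : ℕ) :
    Measurable fun q : S × (Fin n → S) => f (q.1 :: List.ofFn q.2) := by
  have := (hf (n + 1)).comp (measurable_fin_cons (S := S) (n := n))
  simpa [Function.comp_def, List.ofFn_succ] using this

theorem ListMeasurable.cons_right {f : List S → E} (hf : ListMeasurable f) (x : S) :
    ListMeasurable fun l => f (x :: l) := fun n =>
  (hf.cons n).comp (measurable_const.prodMk measurable_id)

theorem ListMeasurable₂.cons_left {K : List S → List S → E} (hK : ListMeasurable₂ K) (m n : ℕ) :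
    Measurable fun q : S × ((Fin m → S) × (Fin n → S)) =>
      K (q.1 :: List.ofFn q.2.1) (List.ofFn q.2.2) := by
  have := (hK (m + 1) n).comp (((measurable_fin_cons (S := S) (n := m)).comp
    (measurable_fst.prodMk (measurable_fst.comp measurable_snd))).prodMk
      (measurable_snd.comp (measurable_snd (α := S) (β := (Fin m → S) × (Fin n → S)))))
  simpa [Function.comp_def, List.ofFn_succ] using this

theorem ListMeasurable₂.cons_right {K : List S → List S → E} (hK : ListMeasurable₂ K) (m n : ℕ) :
    Measurable fun q : S × ((Fin m → S) × (Fin n → S)) =>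
      K (List.ofFn q.2.1) (q.1 :: List.ofFn q.2.2) := by
  have := (hK m (n + 1)).comp ((measurable_fst.comp
    (measurable_snd (α := S) (β := (Fin m → S) × (Fin n → S)))).prodMk
    ((measurable_fin_cons (S := S) (n := n)).comp
    (measurable_fst.prodMk (measurable_snd.comp measurable_snd))))
  simpa [Function.comp_def, List.ofFn_succ] using this

theorem ListMeasurable₂.splitSum [AddCommMonoid E] [MeasurableAdd₂ E] {K : List S → List S → E}
    (hK : ListMeasurable₂ K) : ListMeasurable fun l => splitSum l K := by
  intro n
  have : ∀ y : Fin n → S, List.ofFn y = (List.finRange n).map y := fun y => by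
    rw [List.ofFn_eq_map]
  simp only [this, splitSum_map _ _ (List.nodup_finRange n)]
  refine Finset.measurable_fun_sum _ fun B _ => ?_
  simp only [map_eq_ofFn]
  exact (hK _ _).comp ((measurable_comp_get _).prodMk (measurable_comp_get _))

theorem ListMeasurable.mul₂ [Mul E] [MeasurableMul₂ E] {f g : List S → E}
    (hf : ListMeasurable f) (hg : ListMeasurable g) : ListMeasurable₂ fun a b => f a * g b :=
  fun m n => ((hf m).comp measurable_fst).mul ((hg n).comp measurable_snd)

theorem ListMeasurable.conv [CommSemiring E] [MeasurableAdd₂ E] [MeasurableMul₂ E]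
    {f g : List S → E} (hf : ListMeasurable f) (hg : ListMeasurable g) :
    ListMeasurable (conv f g) := (hf.mul₂ hg).splitSum

/-! ### Integrals over lists of given length and their exponential generating sums. -/

variable (ρ : Measure S)

theorem lintegral_pi_insertNth [SigmaFinite ρ] {n : ℕ} (i : Fin (n + 1)) {F : (Fin (n + 1) → S) → ℝ≥0∞}
    (hF : Measurable F) :
    ∫⁻ y, F y ∂Measure.pi (fun _ => ρ) =
      ∫⁻ x, ∫⁻ y : Fin n → S, F (i.insertNth x y) ∂Measure.pi (fun _ => ρ) ∂ρ := by
  have h := (measurePreserving_piFinSuccAbove (fun _ : Fin (n + 1) => ρ) i).symm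
  rw [← h.lintegral_comp hF, lintegral_prod]
  · rfl
  · exact (hF.comp (MeasurableEquiv.measurable _)).aemeasurable

theorem lintegral_pi_cons [SigmaFinite ρ] {n : ℕ} {F : (Fin (n + 1) → S) → ℝ≥0∞} (hF : Measurable F) :
    ∫⁻ y, F y ∂Measure.pi (fun _ => ρ) =
      ∫⁻ x, ∫⁻ y : Fin n → S, F (Fin.cons x y) ∂Measure.pi (fun _ => ρ) ∂ρ := by
  rw [lintegral_pi_insertNth ρ 0 hF]
  simp only [Fin.insertNth_zero']

/-- The integral of a function over the lists of length `n`. -/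
def listLint (n : ℕ) (f : List S → ℝ≥0∞) : ℝ≥0∞ :=
  ∫⁻ y : Fin n → S, f (List.ofFn y) ∂Measure.pi fun _ => ρ

/-- The integral of a function over the pairs of lists of lengths `m` and `n`. -/
def listLint₂ (m n : ℕ) (K : List S → List S → ℝ≥0∞) : ℝ≥0∞ :=
  ∫⁻ y : Fin m → S, listLint ρ n (K (List.ofFn y)) ∂Measure.pi fun _ => ρ

theorem listLint_zero (f : List S → ℝ≥0∞) : listLint ρ 0 f = f [] := by
  simp [listLint]

theorem listLint_succ [SigmaFinite ρ] (n : ℕ) {f : List S → ℝ≥0∞} (hf : ListMeasurable f) :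
    listLint ρ (n + 1) f = ∫⁻ x, listLint ρ n (fun l => f (x :: l)) ∂ρ := by
  rw [listLint, lintegral_pi_cons ρ (hf _)]
  simp [listLint, List.ofFn_succ]

theorem measurable_listLint_cons [SigmaFinite ρ] (n : ℕ) {f : List S → ℝ≥0∞} (hf : ListMeasurable f) :
    Measurable fun x => listLint ρ n fun l => f (x :: l) :=
  (hf.cons n).lintegral_prod_right'

theorem listLint₂_succ_left [SigmaFinite ρ] (m n : ℕ) {K : List S → List S → ℝ≥0∞} (hK : ListMeasurable₂ K) :
    listLint₂ ρ (m + 1) n K = ∫⁻ x, listLint₂ ρ m n (fun a b => K (x :: a) b) ∂ρ := by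
  rw [listLint₂, lintegral_pi_cons ρ]
  · simp [listLint₂, List.ofFn_succ]
  · exact (hK (m + 1) n).lintegral_prod_right'

theorem listLint₂_succ_right [SigmaFinite ρ] (m n : ℕ) {K : List S → List S → ℝ≥0∞} (hK : ListMeasurable₂ K) :
    listLint₂ ρ m (n + 1) K = ∫⁻ x, listLint₂ ρ m n (fun a b => K a (x :: b)) ∂ρ := by
  have h : ∀ y : Fin m → S, listLint ρ (n + 1) (K (List.ofFn y)) =
      ∫⁻ x, listLint ρ n (fun b => K (List.ofFn y) (x :: b)) ∂ρ := fun y =>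
    listLint_succ ρ n fun k => (hK m k).comp (measurable_const.prodMk measurable_id)
  simp only [listLint₂, h]
  rw [lintegral_lintegral_swap]
  have h1 : Measurable fun q : ((Fin m → S) × S) × (Fin n → S) =>
      K (List.ofFn q.1.1) (q.1.2 :: List.ofFn q.2) :=
    (hK.cons_right m n).comp ((measurable_snd.comp measurable_fst).prodMk
      ((measurable_fst.comp measurable_fst).prodMk measurable_snd))
  exact h1.lintegral_prod_right'.aemeasurable

theorem measurable_listLint₂_cons_left [SigmaFinite ρ] (m n : ℕ) {K : List S → List S → ℝ≥0∞}
    (hK : ListMeasurable₂ K) : Measurable fun x => listLint₂ ρ m n fun a b => K (x :: a) b := by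
  have h1 : Measurable fun q : (S × (Fin m → S)) × (Fin n → S) =>
      K (q.1.1 :: List.ofFn q.1.2) (List.ofFn q.2) :=
    (hK.cons_left m n).comp ((measurable_fst.comp measurable_fst).prodMk
      ((measurable_snd.comp measurable_fst).prodMk measurable_snd))
  exact h1.lintegral_prod_right'.lintegral_prod_right'

theorem measurable_listLint₂_cons_right [SigmaFinite ρ] (m n : ℕ) {K : List S → List S → ℝ≥0∞}
    (hK : ListMeasurable₂ K) : Measurable fun x => listLint₂ ρ m n fun a b => K a (x :: b) := by
  have h1 : Measurable fun q : (S × (Fin m → S)) × (Fin n → S) =>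
      K (List.ofFn q.1.2) (q.1.1 :: List.ofFn q.2) :=
    (hK.cons_right m n).comp ((measurable_fst.comp measurable_fst).prodMk
      ((measurable_snd.comp measurable_fst).prodMk measurable_snd))
  exact h1.lintegral_prod_right'.lintegral_prod_right'

/-- The integral of a sum over splittings. -/
theorem listLint_splitSum [SigmaFinite ρ] (n : ℕ) : ∀ {K : List S → List S → ℝ≥0∞}, ListMeasurable₂ K →
    listLint ρ n (fun l => splitSum l K) =
      ∑ ij ∈ Finset.HasAntidiagonal.antidiagonal n, (n.choose ij.1 : ℝ≥0∞) * listLint₂ ρ ij.1 ij.2 K := by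
  induction n with
  | zero =>
    intro K hK
    simp [listLint₂, listLint_zero, splitSum]
  | succ n ih =>
    intro K hK
    have hl : ∀ x, ListMeasurable₂ fun a b => K (x :: a) b := fun x m k =>
      (hK.cons_left m k).comp (measurable_const.prodMk measurable_id)
    have hr : ∀ x, ListMeasurable₂ fun a b => K a (x :: b) := fun x m k =>
      (hK.cons_right m k).comp (measurable_const.prodMk measurable_id)
    have hsplit : ∀ x, listLint ρ n (fun l => splitSum (x :: l) K) =
        listLint ρ n (fun l => splitSum l fun a b => K (x :: a) b) +
          listLint ρ n (fun l => splitSum l fun a b => K a (x :: b)) := fun x =>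
      lintegral_add_left ((hl x).splitSum n) _
    rw [listLint_succ ρ n hK.splitSum]
    simp only [hsplit, ih (hl _), ih (hr _)]
    -- Pascal's rule: the first entry goes either to the left or to the right sublist.
    rw [Finset.sum_antidiagonal_choose_succ_mul (fun i j => listLint₂ ρ i j K), lintegral_add_left,
      lintegral_finsetSum, lintegral_finsetSum, add_comm]
    · congr 1
      · refine Finset.sum_congr rfl fun ij _ => ?_
        rw [lintegral_const_mul _ (measurable_listLint₂_cons_right ρ _ _ hK),
          listLint₂_succ_right ρ _ _ hK]
      · refine Finset.sum_congr rfl fun ij hij => ?_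
        rw [lintegral_const_mul _ (measurable_listLint₂_cons_left ρ _ _ hK),
          listLint₂_succ_left ρ _ _ hK, Nat.choose_symm_of_eq_add (Finset.HasAntidiagonal.mem_antidiagonal.1 hij).symm]
    · exact fun ij _ => (measurable_listLint₂_cons_right ρ _ _ hK).const_mul _
    · exact fun ij _ => (measurable_listLint₂_cons_left ρ _ _ hK).const_mul _
    · exact Finset.measurable_fun_sum _ fun ij _ =>
        (measurable_listLint₂_cons_left ρ _ _ hK).const_mul _

theorem listLint₂_mul (m n : ℕ) {f g : List S → ℝ≥0∞} (hf : ListMeasurable f)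
    (hg : ListMeasurable g) :
    listLint₂ ρ m n (fun a b => f a * g b) = listLint ρ m f * listLint ρ n g := by
  have : ∀ a, listLint ρ n (fun b => f a * g b) = f a * listLint ρ n g := fun a =>
    lintegral_const_mul _ (hg n)
  simp only [listLint₂, this]
  exact lintegral_mul_const _ (hf m)

theorem inv_factorial_mul_choose {n i j : ℕ} (h : i + j = n) :
    ((n ! : ℕ) : ℝ≥0∞)⁻¹ * (n.choose i : ℝ≥0∞) = ((i ! : ℕ) : ℝ≥0∞)⁻¹ * ((j ! : ℕ) : ℝ≥0∞)⁻¹ := by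
  subst h
  have hne : ∀ k : ℕ, ((k ! : ℕ) : ℝ≥0∞) ≠ 0 := fun k => by exact_mod_cast k.factorial_ne_zero
  have htop : ∀ k : ℕ, ((k ! : ℕ) : ℝ≥0∞) ≠ ⊤ := fun k => ENNReal.natCast_ne_top _
  have key : ((i + j).choose i : ℝ≥0∞) * (i ! : ℕ) * (j ! : ℕ) = ((i + j)! : ℕ) := by
    rw [Nat.choose_symm_add]
    exact_mod_cast Nat.add_choose_mul_factorial_mul_factorial i j
  have hc : ((i + j).choose i : ℝ≥0∞) ≠ 0 := by
    exact_mod_cast (Nat.choose_pos (Nat.le_add_right i j)).ne'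
  have hc' : ((i + j).choose i : ℝ≥0∞) ≠ ⊤ := ENNReal.natCast_ne_top _
  rw [← ENNReal.mul_inv (Or.inl (hne i)) (Or.inl (htop i)), ← key, mul_assoc,
    ENNReal.mul_inv (Or.inl hc) (Or.inl hc'), mul_right_comm, ENNReal.inv_mul_cancel hc hc', one_mul]

/-- The exponential generating sum of the integrals over lists of length less than `m`. -/
def expSum (m : ℕ) (f : List S → ℝ≥0∞) : ℝ≥0∞ :=
  ∑ n ∈ Finset.range m, ((n ! : ℕ) : ℝ≥0∞)⁻¹ * listLint ρ n f

theorem sum_range_antidiagonal {M : Type*} [AddCommMonoid M] (m : ℕ) (F : ℕ → ℕ → M) :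
    ∑ n ∈ Finset.range m, ∑ ij ∈ Finset.HasAntidiagonal.antidiagonal n, F ij.1 ij.2 =
      ∑ i ∈ Finset.range m, ∑ j ∈ Finset.range (m - i), F i j := by
  rw [Finset.sum_sigma', Finset.sum_sigma']
  refine Finset.sum_bij' (fun a _ => ⟨a.2.1, a.2.2⟩) (fun b _ => ⟨b.1 + b.2, (b.1, b.2)⟩)
    ?_ ?_ ?_ ?_ ?_
  · rintro ⟨n, i, j⟩ h
    simp only [Finset.mem_sigma, Finset.mem_range, Finset.HasAntidiagonal.mem_antidiagonal] at h ⊢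
    omega
  · rintro ⟨i, j⟩ h
    simp only [Finset.mem_sigma, Finset.mem_range, Finset.HasAntidiagonal.mem_antidiagonal] at h ⊢
    exact ⟨by omega, trivial⟩
  · rintro ⟨n, i, j⟩ h
    simp only [Finset.mem_sigma, Finset.mem_range, Finset.HasAntidiagonal.mem_antidiagonal] at h ⊢
    obtain ⟨-, rfl⟩ := h
    rfl
  · rintro ⟨i, j⟩ h
    rfl
  · rintro ⟨n, i, j⟩ h
    rfl

theorem expSum_splitSum [SigmaFinite ρ] (m : ℕ) {K : List S → List S → ℝ≥0∞}
    (hK : ListMeasurable₂ K) :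
    expSum ρ m (fun l => splitSum l K) = ∑ i ∈ Finset.range m, ∑ j ∈ Finset.range (m - i),
      ((i ! : ℕ) : ℝ≥0∞)⁻¹ * (((j ! : ℕ) : ℝ≥0∞)⁻¹ * listLint₂ ρ i j K) := by
  rw [← sum_range_antidiagonal, expSum]
  refine Finset.sum_congr rfl fun n _ => ?_
  rw [listLint_splitSum ρ n hK, Finset.mul_sum]
  refine Finset.sum_congr rfl fun ij hij => ?_
  rw [← mul_assoc, inv_factorial_mul_choose (Finset.HasAntidiagonal.mem_antidiagonal.1 hij),
    mul_assoc]

theorem expSum_mono {m n : ℕ} (h : m ≤ n) (f : List S → ℝ≥0∞) : expSum ρ m f ≤ expSum ρ n f :=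
  Finset.sum_le_sum_of_subset (Finset.range_subset_range.2 h)

/-- The factorials and binomials combine as for exponential generating functions. Only an inequality
holds because the right side also contains pairs of lengths with `i + j ≥ m`. -/
theorem expSum_conv_le [SigmaFinite ρ] (m : ℕ) {f g : List S → ℝ≥0∞} (hf : ListMeasurable f)
    (hg : ListMeasurable g) : expSum ρ m (conv f g) ≤ expSum ρ m f * expSum ρ m g := by
  refine (expSum_splitSum ρ m (hf.mul₂ hg)).le.trans ?_
  rw [expSum, Finset.sum_mul]
  refine Finset.sum_le_sum fun i _ => ?_
  refine le_trans (le_of_eq ?_) (mul_le_mul' le_rfl (expSum_mono ρ (Nat.sub_le m i) g))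
  rw [expSum, Finset.mul_sum]
  refine Finset.sum_congr rfl fun j _ => ?_
  rw [listLint₂_mul ρ i j hf hg]
  ring

theorem listLint_convOne_succ (n : ℕ) : listLint ρ (n + 1) convOne = 0 := by
  simp [listLint, List.ofFn_succ, convOne]

theorem expSum_convOne_succ (m : ℕ) : expSum ρ (m + 1) convOne = 1 := by
  rw [expSum, Finset.sum_range_succ']
  simp [listLint_convOne_succ, listLint_zero, convOne]

theorem expSum_convOne_le (m : ℕ) : expSum ρ m convOne ≤ 1 :=
  (expSum_mono ρ m.le_succ _).trans (expSum_convOne_succ ρ m).le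

variable {τ : List S → ℂ}

theorem listMeasurable_convOne : ListMeasurable (convOne : List S → ℝ≥0∞) := by
  intro n
  cases n with
  | zero => simp [convOne]
  | succ n => simp [convOne, List.ofFn_succ]

theorem listMeasurable₂_absProd (hτ : ListMeasurable τ) :
    ListMeasurable₂ (absProd fun a l => τ (a :: l)) := by
  intro m
  induction m with
  | zero =>
    intro n
    simp only [List.ofFn_zero, absProd]
    exact (listMeasurable_convOne n).comp measurable_snd
  | succ m ih =>
    intro n
    have : ∀ y : Fin n → S, List.ofFn y = (List.finRange n).map y := fun y => by
      rw [List.ofFn_eq_map]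
    simp only [List.ofFn_succ (n := m), absProd, conv]
    simp only [this, splitSum_map _ _ (List.nodup_finRange n)]
    refine Finset.measurable_fun_sum _ fun B _ => Measurable.mul ?_ ?_
    · simp only [map_eq_ofFn]
      refine measurable_enorm.comp ((hτ.cons _).comp (Measurable.prodMk ?_ ?_))
      · exact (measurable_pi_apply 0).comp measurable_fst
      · exact (measurable_comp_get _).comp measurable_snd
    · simp only [map_eq_ofFn (n := n)]
      refine (ih _).comp (Measurable.prodMk ?_ ?_)
      · exact measurable_pi_lambda _ fun i => (measurable_pi_apply i.succ).comp measurable_fst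
      · exact (measurable_comp_get _).comp measurable_snd

theorem ListMeasurable.absProd (hτ : ListMeasurable τ) (N : List S) :
    ListMeasurable (absProd (fun a l => τ (a :: l)) N) := by
  intro n
  have := (listMeasurable₂_absProd hτ N.length n).comp
    (measurable_const (a := N.get) |>.prodMk measurable_id)
  simpa [Function.comp_def] using this

theorem expSum_absProd_le [SigmaFinite ρ] (hτ : ListMeasurable τ) (m : ℕ) (N : List S) :
    expSum ρ m (absProd (fun a l => τ (a :: l)) N) ≤
      listProd (fun a => expSum ρ m fun l => ‖τ (a :: l)‖ₑ) N := by
  induction N with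
  | nil => exact expSum_convOne_le ρ m
  | cons a N ih =>
    rw [listProd_cons]
    refine (expSum_conv_le ρ m ?_ (hτ.absProd N)).trans (mul_le_mul' le_rfl ih)
    exact fun n => measurable_enorm.comp (hτ.cons_right a n)

end ListIntegrals

/-! ### The pinned expansion -/

section Pinned

variable {S : Type*} [MeasurableSpace S] {w : S → S → ℂ}

theorem measurable_pair (hw : Measurable (Function.uncurry w)) {n : ℕ} (i j : Fin n) :
    Measurable fun y : Fin n → S => w (y i) (y j) := by
  have : Measurable fun y : Fin n → S => (y i, y j) :=
    (measurable_pi_apply i).prodMk (measurable_pi_apply j)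
  exact hw.comp this

theorem measurable_truncatedWeight (hw : Measurable (Function.uncurry w)) (n : ℕ) :
    Measurable fun y : Fin n → S => truncatedWeight w y := by
  classical
  unfold truncatedWeight
  refine Finset.measurable_fun_sum _ fun G _ => Finset.measurable_fun_prod _ fun p _ => ?_
  exact (measurable_pair hw p.1 p.2).sub_const 1

theorem measurable_weight (hw : Measurable (Function.uncurry w)) (n : ℕ) :
    Measurable fun y : Fin n → S => weight w y :=
  Finset.measurable_fun_prod _ fun p _ => measurable_pair hw p.1 p.2

theorem listMeasurable_listTrunc (hw : Measurable (Function.uncurry w)) :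
    ListMeasurable (listTrunc w) := fun n => by
  simpa only [listTrunc_ofFn] using measurable_truncatedWeight hw n

theorem listMeasurable_listWeight (hw : Measurable (Function.uncurry w)) :
    ListMeasurable (listWeight w) := fun n => by
  simpa only [listWeight_ofFn] using measurable_weight hw n

theorem listMeasurable_listProd {E : Type*} [MeasurableSpace E] [CommMonoid E] [MeasurableMul₂ E]
    {f : S → E} (hf : Measurable f) : ListMeasurable (listProd f) := fun n => by
  simp only [listProd_ofFn]
  exact Finset.measurable_fun_prod _ fun i _ => hf.comp (measurable_pi_apply i)

theorem enorm_finsetProd {ι : Type*} (s : Finset ι) (f : ι → ℂ) :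
    ‖∏ i ∈ s, f i‖ₑ = ∏ i ∈ s, ‖f i‖ₑ := by
  classical
  induction s using Finset.induction_on with
  | empty => simp
  | insert i s hi ih => rw [Finset.prod_insert hi, Finset.prod_insert hi, enorm_mul, ih]

/-- The partial sums of the absolute pinned expansion. -/
def pinnedSum (w : S → S → ℂ) (ν : SigmaFiniteComplexMeasure S) (m : ℕ) (x : S) : ℝ≥0∞ :=
  expSum ν.variation m fun l => ‖listTrunc w (x :: l)‖ₑ

theorem vertexWeight_eq {S : Type*} (w : S → S → ℂ) (x : S) {n : ℕ} (y : Fin n → S) :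
    vertexWeight w x y =
      listProd (fun y => ‖w x y - 1‖ₑ) (List.ofFn y) * ‖listWeight w (List.ofFn y)‖ₑ := by
  rw [vertexWeight, listProd_ofFn, listWeight_ofFn, weight]
  congr 1
  exact (enorm_finsetProd _ _).symm

/-- This is the recursion over the neighbours `N` of the root in integrated form: after integration
over `M`, each neighbour contributes a truncated pinned sum of its own. -/
theorem pinnedSum_succ_le (ν : SigmaFiniteComplexMeasure S)
    (hw : Measurable (Function.uncurry w)) (hsymm : ∀ x y, w x y = w y x)
    (hnorm : ∀ x y, ‖w x y‖ ≤ 1) (m : ℕ) (x : S) :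
    pinnedSum w ν (m + 1) x ≤ vertexSum w ν (pinnedSum w ν m) x := by
  have hτ := listMeasurable_listTrunc hw
  have hw1 : ∀ x y, ‖w x y‖ₑ ≤ 1 := fun x y => by
    rw [← ofReal_norm]
    exact ENNReal.ofReal_le_one.2 (hnorm x y)
  have hwx : Measurable fun y => ‖w x y - 1‖ₑ :=
    measurable_enorm.comp ((hw.comp (measurable_const.prodMk measurable_id)).sub_const 1)
  set θ : List S → ℝ≥0∞ := fun N => listProd (fun y => ‖w x y - 1‖ₑ) N * ‖listWeight w N‖ₑ with hθ
  have hθm : ListMeasurable θ := fun n =>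
    (listMeasurable_listProd hwx n).mul (measurable_enorm.comp (listMeasurable_listWeight hw n))
  set H := absProd fun a l => listTrunc w (a :: l) with hH
  have hHm : ListMeasurable₂ H := listMeasurable₂_absProd hτ
  have hK : ListMeasurable₂ fun N M => θ N * H N M := fun i j =>
    ((hθm i).comp measurable_fst).mul (hHm i j)
  have h1 : pinnedSum w ν (m + 1) x ≤
      expSum ν.variation (m + 1) fun l => splitSum l fun N M => θ N * H N M := by
    refine Finset.sum_le_sum fun n _ => mul_le_mul' le_rfl (lintegral_mono fun y => ?_)
    exact enorm_le_splitSum_absProd hsymm hw1 (γ := fun a l => listTrunc w (a :: l))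
      (conv_listTrunc hsymm) x _
  refine h1.trans ?_
  rw [expSum_splitSum _ _ hK, Finset.sum_range_succ', add_comm, vertexSum]
  refine add_le_add (le_of_eq ?_) (le_trans ?_ (ENNReal.sum_le_tsum (Finset.range m)))
  -- With no neighbours `absProd` is the convolution unit, which accounts for the leading `1` of
  -- `Ψ`.
  · rw [← expSum_convOne_succ ν.variation m, expSum]
    refine Finset.sum_congr rfl fun j _ => ?_
    simp [listLint₂, hθ, hH, absProd, listWeight]
  · refine Finset.sum_le_sum fun i _ => ?_
    rw [← Finset.mul_sum]
    refine mul_le_mul' le_rfl ?_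
    have h2 : ∀ j, ((j ! : ℕ) : ℝ≥0∞)⁻¹ *
        listLint₂ ν.variation (i + 1) j (fun N M => θ N * H N M) =
        ∫⁻ y : Fin (i + 1) → S, θ (List.ofFn y) *
          (((j ! : ℕ) : ℝ≥0∞)⁻¹ * listLint ν.variation j (H (List.ofFn y)))
          ∂Measure.pi fun _ => ν.variation := by
      intro j
      have hm : Measurable fun y : Fin (i + 1) → S => listLint ν.variation j (H (List.ofFn y)) :=
        (hHm (i + 1) j).lintegral_prod_right'
      rw [listLint₂, ← lintegral_const_mul]
      · refine lintegral_congr fun y => ?_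
        have : listLint ν.variation j (fun M => θ (List.ofFn y) * H (List.ofFn y) M) =
            θ (List.ofFn y) * listLint ν.variation j (H (List.ofFn y)) :=
          lintegral_const_mul _ ((hHm (i + 1) j).comp (measurable_const.prodMk measurable_id))
        rw [this]
        ring
      · exact (hK (i + 1) j).lintegral_prod_right'
    simp only [h2]
    rw [← lintegral_finsetSum]
    · refine lintegral_mono fun y => ?_
      rw [← Finset.mul_sum, vertexWeight_eq]
      refine mul_le_mul' le_rfl ?_
      rw [← listProd_ofFn]
      refine le_trans ?_ (expSum_absProd_le ν.variation hτ m (List.ofFn y))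
      -- A nonempty `N` uses up at least one entry, so the rest has length less than `m`; this
      -- lowers the truncation from `m + 1` to `m`.
      exact expSum_mono _ (by omega) _
    · exact fun j _ => (hθm (i + 1)).mul
        (((hHm (i + 1) j).lintegral_prod_right').const_mul _)

/-- The lower integral is monotone for arbitrary functions, so `μ` need not be measurable. -/
theorem vertexSum_mono (ν : SigmaFiniteComplexMeasure S) {μ μ' : S → ℝ≥0∞} (h : ∀ x, μ x ≤ μ' x)
    (x : S) : vertexSum w ν μ x ≤ vertexSum w ν μ' x := by
  refine add_le_add le_rfl (ENNReal.tsum_le_tsum fun k => mul_le_mul' le_rfl ?_)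
  exact lintegral_mono fun y => mul_le_mul' le_rfl (Finset.prod_le_prod' fun i _ => h _)

theorem absPinned_eq_tsum (ν : SigmaFiniteComplexMeasure S) (x : S) :
    absPinned w ν x = ∑' n : ℕ, ((n ! : ℕ) : ℝ≥0∞)⁻¹ *
      listLint ν.variation n fun l => ‖listTrunc w (x :: l)‖ₑ := by
  unfold absPinned listLint
  refine tsum_congr fun n => ?_
  congr 1
  refine lintegral_congr fun y => ?_
  rw [← listTrunc_ofFn, List.ofFn_cons]

/-- The truncated sums are dominated by the iterates of `Ψ` started at `0`, and these stay below any
`μ` with `Ψ(μ) ≤ μ`. -/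
theorem absPinned_le (ν : SigmaFiniteComplexMeasure S)
    (hw : Measurable (Function.uncurry w)) (hsymm : ∀ x y, w x y = w y x)
    (hnorm : ∀ x y, ‖w x y‖ ≤ 1) {μ : S → ℝ≥0∞} (hμ : ∀ x, vertexSum w ν μ x ≤ μ x) (x : S) :
    absPinned w ν x ≤ μ x := by
  have key : ∀ m x, pinnedSum w ν m x ≤ μ x := by
    intro m
    induction m with
    | zero => intro x; simp [pinnedSum, expSum]
    | succ m ih =>
      intro x
      exact (pinnedSum_succ_le ν hw hsymm hnorm m x).trans ((vertexSum_mono ν ih x).trans (hμ x))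
  rw [absPinned_eq_tsum, ENNReal.tsum_eq_iSup_nat]
  exact iSup_le fun m => key m x

theorem measurable_absPinned (ν : SigmaFiniteComplexMeasure S)
    (hw : Measurable (Function.uncurry w)) : Measurable (absPinned w ν) := by
  have : absPinned w ν = fun x => ∑' n : ℕ, ((n ! : ℕ) : ℝ≥0∞)⁻¹ *
      listLint ν.variation n fun l => ‖listTrunc w (x :: l)‖ₑ := funext (absPinned_eq_tsum ν)
  rw [this]
  refine Measurable.tsum fun n => Measurable.const_mul ?_ _
  exact measurable_listLint_cons ν.variation n (f := fun l => ‖listTrunc w l‖ₑ)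
    fun k => measurable_enorm.comp (listMeasurable_listTrunc hw k)

/-! ### Convergence of the complex pinned series. -/

theorem norm_phasePow (ν : SigmaFiniteComplexMeasure S) {n : ℕ} (y : Fin n → S) :
    ‖ν.phasePow y‖ₑ = 1 := by
  rw [← ofReal_norm]
  simp [SigmaFiniteComplexMeasure.phasePow, norm_prod, ν.norm_phase]

theorem measurable_phasePow (ν : SigmaFiniteComplexMeasure S) (n : ℕ) :
    Measurable fun y : Fin n → S => ν.phasePow y :=
  Finset.measurable_fun_prod _ fun i _ => ν.measurable_phase.comp (measurable_pi_apply i)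

theorem enorm_inv_factorial (n : ℕ) : ‖((n ! : ℕ) : ℂ)⁻¹‖ₑ = ((n ! : ℕ) : ℝ≥0∞)⁻¹ := by
  rw [enorm_inv (by exact_mod_cast n.factorial_ne_zero)]
  congr 1
  rw [← ofReal_norm, Complex.norm_natCast, ENNReal.ofReal_natCast]

theorem enorm_pinnedTerm_le (ν : SigmaFiniteComplexMeasure S) (x : S) (n : ℕ) :
    ‖pinnedTerm w ν x n‖ₑ ≤ ((n ! : ℕ) : ℝ≥0∞)⁻¹ *
      ∫⁻ y : Fin n → S, ‖truncatedWeight w (Fin.cons x y : Fin (n + 1) → S)‖ₑ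
        ∂ν.variationPow n := by
  rw [pinnedTerm, enorm_mul, enorm_inv_factorial]
  refine mul_le_mul' le_rfl ((enorm_integral_le_lintegral_enorm _).trans (le_of_eq ?_))
  refine lintegral_congr fun y => ?_
  rw [pinnedIntegrand, enorm_mul, norm_phasePow, mul_one]

/-- No convergence is needed: non-integrable integrals and non-summable series have the value `0`.
-/
theorem enorm_pinned_le (ν : SigmaFiniteComplexMeasure S) (x : S) :
    ‖pinned w ν x‖ₑ ≤ absPinned w ν x :=
  enorm_tsum_le_tsum_enorm.trans (ENNReal.tsum_le_tsum fun n => enorm_pinnedTerm_le ν x n)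

theorem lintegral_lt_top_of_inv_factorial_mul {n : ℕ} {a : ℝ≥0∞}
    (h : ((n ! : ℕ) : ℝ≥0∞)⁻¹ * a < ⊤) : a < ⊤ := by
  refine lt_top_iff_ne_top.2 fun ha => ?_
  rw [ha, ENNReal.mul_top (ENNReal.inv_ne_zero.2 (ENNReal.natCast_ne_top _))] at h
  exact lt_irrefl _ h

theorem integrable_pinnedIntegrand (ν : SigmaFiniteComplexMeasure S)
    (hw : Measurable (Function.uncurry w)) {x : S} (hx : absPinned w ν x < ⊤) (n : ℕ) :
    Integrable (pinnedIntegrand w ν x n) (ν.variationPow n) := by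
  refine ⟨?_, ?_⟩
  · refine Measurable.aestronglyMeasurable ?_
    refine Measurable.mul ?_ (measurable_phasePow ν n)
    exact (measurable_truncatedWeight hw (n + 1)).comp
      (measurable_fin_cons.comp (measurable_const.prodMk measurable_id))
  · rw [hasFiniteIntegral_iff_enorm]
    have h := (ENNReal.le_tsum n).trans_lt hx
    refine lt_of_eq_of_lt (lintegral_congr fun y => ?_) (lintegral_lt_top_of_inv_factorial_mul h)
    rw [pinnedIntegrand, enorm_mul, norm_phasePow, mul_one]

theorem summable_norm_of_tsum_enorm_lt_top {f : ℕ → ℂ} (h : ∑' n, ‖f n‖ₑ < ⊤) :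
    Summable fun n => ‖f n‖ := by
  have := ENNReal.summable_toReal h.ne
  simpa [toReal_enorm] using this

theorem summable_pinnedTerm (ν : SigmaFiniteComplexMeasure S) {x : S}
    (hx : absPinned w ν x < ⊤) : Summable fun n => ‖pinnedTerm w ν x n‖ :=
  summable_norm_of_tsum_enorm_lt_top
    ((ENNReal.tsum_le_tsum fun n => enorm_pinnedTerm_le ν x n).trans_lt hx)

end Pinned

/-! ### The absolute cluster expansion -/

section AbsCluster

variable {S : Type*} [MeasurableSpace S] {w : S → S → ℂ}

theorem truncatedWeight_insertNth {S : Type*} {w : S → S → ℂ} (hsymm : ∀ x y, w x y = w y x) {n : ℕ} (i : Fin (n + 1))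
    (x : S) (y : Fin n → S) :
    truncatedWeight w (i.insertNth x y : Fin (n + 1) → S) =
      truncatedWeight w (Fin.cons x y : Fin (n + 1) → S) := by
  rw [← truncatedWeight_comp_equiv hsymm i.cycleRange (Fin.cons x y : Fin (n + 1) → S)]
  congr 1
  funext j
  refine Fin.succAboveCases i ?_ (fun k => ?_) j
  · simp
  · simp [Fin.cycleRange_succAbove]

/-- A configuration in `Λ` lies entirely in `B` or has a point in `A`. By symmetry of the truncated
weight, each of the `k + 1` positions of that point contributes the same integral, and the other
points are released to all of `S`. -/
theorem lintegral_cube_le (ν : SigmaFiniteComplexMeasure S)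
    (hw : Measurable (Function.uncurry w)) (hsymm : ∀ x y, w x y = w y x) {A B Λ : Set S}
    (hA : MeasurableSet A) (hΛ : Λ ⊆ A ∪ B) (k : ℕ) :
    ∫⁻ y in cube Λ (k + 1), ‖truncatedWeight w y‖ₑ ∂ν.variationPow (k + 1) ≤
      ∫⁻ y in cube B (k + 1), ‖truncatedWeight w y‖ₑ ∂ν.variationPow (k + 1) +
        (k + 1 : ℕ) * ∫⁻ x in A, ∫⁻ y : Fin k → S,
          ‖truncatedWeight w (Fin.cons x y : Fin (k + 1) → S)‖ₑ
            ∂ν.variationPow k ∂ν.variation := by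
  have hF : Measurable fun y : Fin (k + 1) → S => ‖truncatedWeight w y‖ₑ :=
    measurable_enorm.comp (measurable_truncatedWeight hw (k + 1))
  have hAi : ∀ i : Fin (k + 1), MeasurableSet {y : Fin (k + 1) → S | y i ∈ A} := fun i =>
    measurable_pi_apply i hA
  have hsub : cube Λ (k + 1) ⊆ cube B (k + 1) ∪ ⋃ i, {y : Fin (k + 1) → S | y i ∈ A} := by
    intro y hy
    by_cases h : ∃ i, y i ∈ A
    · exact Or.inr (Set.mem_iUnion.2 h)
    · push Not at h
      refine Or.inl fun i _ => ?_
      exact (hΛ (hy i (Set.mem_univ i))).resolve_left (h i)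
  have hi : ∀ i : Fin (k + 1), ∫⁻ y in {y : Fin (k + 1) → S | y i ∈ A}, ‖truncatedWeight w y‖ₑ
      ∂ν.variationPow (k + 1) = ∫⁻ x in A, ∫⁻ y : Fin k → S,
          ‖truncatedWeight w (Fin.cons x y : Fin (k + 1) → S)‖ₑ
            ∂ν.variationPow k ∂ν.variation := by
    intro i
    rw [← lintegral_indicator (hAi i), SigmaFiniteComplexMeasure.variationPow,
      lintegral_pi_insertNth ν.variation i (hF.indicator (hAi i)), ← lintegral_indicator hA]
    refine lintegral_congr fun x => ?_
    by_cases hx : x ∈ A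
    · simp [Set.indicator, hx, truncatedWeight_insertNth hsymm,
        SigmaFiniteComplexMeasure.variationPow]
    · simp [Set.indicator, hx]
  refine (lintegral_mono_set hsub).trans ((lintegral_union_le _ _ _).trans ?_)
  refine add_le_add le_rfl ((lintegral_iUnion_le _ _).trans ?_)
  rw [tsum_fintype]
  simp only [hi, Finset.sum_const, Finset.card_univ, Fintype.card_fin, nsmul_eq_mul]
  exact le_rfl

theorem absCluster_le_add (ν : SigmaFiniteComplexMeasure S)
    (hw : Measurable (Function.uncurry w)) (hsymm : ∀ x y, w x y = w y x) {A B Λ : Set S}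
    (hA : MeasurableSet A) (hΛ : Λ ⊆ A ∪ B) :
    absCluster w ν Λ ≤ absCluster w ν B + ∫⁻ x in A, absPinned w ν x ∂ν.variation := by
  have hm : ∀ k : ℕ, Measurable fun x => ∫⁻ y : Fin k → S,
      ‖truncatedWeight w (Fin.cons x y : Fin (k + 1) → S)‖ₑ ∂ν.variationPow k := fun k =>
    ((measurable_enorm.comp (measurable_truncatedWeight hw (k + 1))).comp
      measurable_fin_cons).lintegral_prod_right' (ν := Measure.pi fun _ => ν.variation)
  simp only [absPinned]
  rw [lintegral_tsum fun k => ((hm k).const_mul _).aemeasurable, absCluster, absCluster,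
    ← ENNReal.tsum_add]
  refine ENNReal.tsum_le_tsum fun k => ?_
  refine (mul_le_mul' le_rfl (lintegral_cube_le ν hw hsymm hA hΛ k)).trans (le_of_eq ?_)
  rw [mul_add, lintegral_const_mul _ (hm k), ← mul_assoc]
  congr 2
  have h0 : ((k + 1 : ℕ) : ℝ≥0∞) ≠ 0 := by exact_mod_cast k.succ_ne_zero
  have htop : ((k + 1 : ℕ) : ℝ≥0∞) ≠ ⊤ := ENNReal.natCast_ne_top _
  rw [Nat.factorial_succ, Nat.cast_mul, ENNReal.mul_inv (Or.inl h0) (Or.inl htop), mul_right_comm,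
    ENNReal.inv_mul_cancel h0 htop, one_mul]

theorem absCluster_le_lintegral_absPinned (ν : SigmaFiniteComplexMeasure S)
    (hw : Measurable (Function.uncurry w)) (hsymm : ∀ x y, w x y = w y x) {Λ : Set S}
    (hΛ : MeasurableSet Λ) :
    absCluster w ν Λ ≤ ∫⁻ x in Λ, absPinned w ν x ∂ν.variation := by
  have h := absCluster_le_add ν hw hsymm hΛ (B := ∅) (Set.subset_union_left)
  have h0 : absCluster w ν ∅ = 0 := by
    have : ∀ k, cube (∅ : Set S) (k + 1) = ∅ := fun k =>
      Set.eq_empty_of_forall_notMem fun y hy => hy 0 (Set.mem_univ _)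
    simp [absCluster, this]
  rwa [h0, zero_add] at h

/-- The restriction of a complex measure to a set. -/
def SigmaFiniteComplexMeasure.restrict (ν : SigmaFiniteComplexMeasure S) (B : Set S) :
    SigmaFiniteComplexMeasure S where
  variation := ν.variation.restrict B
  sigmaFinite := inferInstance
  phase := ν.phase
  measurable_phase := ν.measurable_phase
  norm_phase := ν.norm_phase

theorem variationPow_restrict_cube (ν : SigmaFiniteComplexMeasure S) (B : Set S) (n : ℕ) :
    (ν.variationPow n).restrict (cube B n) = Measure.pi fun _ => ν.variation.restrict B :=
  Measure.restrict_pi_pi _ _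

theorem vertexWeight_le {S : Type*} {w : S → S → ℂ} (hnorm : ∀ x y, ‖w x y‖ ≤ 1) (x : S) {n : ℕ} (y : Fin n → S) :
    vertexWeight w x y ≤ 2 ^ n := by
  have h1 : ∀ x y, ‖w x y‖ₑ ≤ 1 := fun x y => by
    rw [← ofReal_norm]
    exact ENNReal.ofReal_le_one.2 (hnorm x y)
  have h2 : ∀ x y, ‖w x y - 1‖ₑ ≤ 2 := fun x y => by
    refine (enorm_sub_le).trans ((add_le_add (h1 x y) (le_of_eq enorm_one)).trans ?_)
    norm_num
  refine (mul_le_mul' (Finset.prod_le_pow_card _ _ 2 fun i _ => h2 _ _)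
    (Finset.prod_le_one' fun p _ => h1 _ _)).trans ?_
  simp

/-- The term with `n ≥ 1` neighbours is at most `2^n · 2^n · 8^{-n} = 2^{-n}`, and `1 + ∑ 2^{-n} =
2`. -/
theorem vertexSum_two_le (ν : SigmaFiniteComplexMeasure S) (hnorm : ∀ x y, ‖w x y‖ ≤ 1)
    (hν : ν.variation Set.univ ≤ 8⁻¹) (x : S) : vertexSum w ν (fun _ => 2) x ≤ 2 := by
  have key : ∀ k : ℕ, (((k + 1)! : ℕ) : ℝ≥0∞)⁻¹ * ∫⁻ y : Fin (k + 1) → S,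
      vertexWeight w x y * ∏ _i : Fin (k + 1), 2 ∂ν.variationPow (k + 1) ≤ 2⁻¹ ^ (k + 1) := by
    intro k
    have h1 : (((k + 1)! : ℕ) : ℝ≥0∞)⁻¹ ≤ 1 := by
      rw [ENNReal.inv_le_one]
      exact_mod_cast Nat.one_le_iff_ne_zero.2 (Nat.factorial_ne_zero _)
    have h2 : ∫⁻ y : Fin (k + 1) → S,
        vertexWeight w x y * ∏ _i : Fin (k + 1), 2 ∂ν.variationPow (k + 1) ≤ 2⁻¹ ^ (k + 1) := by
      calc _ ≤ ∫⁻ _ : Fin (k + 1) → S, 4 ^ (k + 1) ∂ν.variationPow (k + 1) := by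
            refine lintegral_mono fun y => ?_
            refine (mul_le_mul' (vertexWeight_le hnorm x y) le_rfl).trans (le_of_eq ?_)
            simp only [Finset.prod_const, Finset.card_univ, Fintype.card_fin, ← mul_pow]
            norm_num
        _ = 4 ^ (k + 1) * ν.variation Set.univ ^ (k + 1) := by
            rw [lintegral_const, SigmaFiniteComplexMeasure.variationPow, Measure.pi_univ]
            simp
        _ ≤ 4 ^ (k + 1) * 8⁻¹ ^ (k + 1) := by gcongr
        _ = 2⁻¹ ^ (k + 1) := by
            rw [← mul_pow]
            congr 1
            have h8 : (8 : ℝ≥0∞) = 4 * 2 := by norm_num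
            rw [h8, ENNReal.mul_inv (Or.inl (by norm_num)) (Or.inl (by norm_num)), ← mul_assoc,
              ENNReal.mul_inv_cancel (by norm_num) (by norm_num), one_mul]
    exact (mul_le_mul' h1 h2).trans_eq (one_mul _)
  refine (add_le_add le_rfl (ENNReal.tsum_le_tsum key)).trans (le_of_eq ?_)
  rw [ENNReal.tsum_geometric_add_one, ENNReal.one_sub_inv_two, inv_inv,
    ENNReal.inv_mul_cancel (by norm_num) (by norm_num)]
  norm_num

/-- Integrals over cubes of `B` see only the restriction of `ν` to `B`. Its pinned expansion is at
most `2`, however large that of `ν` itself may be on `B`. -/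
theorem absCluster_lt_top_of_small (ν : SigmaFiniteComplexMeasure S)
    (hw : Measurable (Function.uncurry w)) (hsymm : ∀ x y, w x y = w y x)
    (hnorm : ∀ x y, ‖w x y‖ ≤ 1) {B : Set S} (hB : MeasurableSet B)
    (hν : ν.variation B ≤ 8⁻¹) : absCluster w ν B < ⊤ := by
  have hrr : absCluster w ν B = absCluster w (ν.restrict B) B := by
    unfold absCluster
    simp only [variationPow_restrict_cube, SigmaFiniteComplexMeasure.restrict,
      Measure.restrict_restrict hB, Set.inter_self]
  have hb : ∀ x, absPinned w (ν.restrict B) x ≤ 2 :=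
    absPinned_le _ hw hsymm hnorm
      (vertexSum_two_le _ hnorm (by simpa [SigmaFiniteComplexMeasure.restrict] using hν))
  rw [hrr]
  refine (absCluster_le_lintegral_absPinned _ hw hsymm hB).trans_lt ?_
  refine (lintegral_mono fun x => hb x).trans_lt ?_
  rw [lintegral_const]
  refine ENNReal.mul_lt_top (by norm_num) ?_
  simp only [SigmaFiniteComplexMeasure.restrict, Measure.restrict_restrict hB, Set.inter_self,
    Measure.restrict_apply_univ]
  exact hν.trans_lt (by simp)

/-- The absolute cluster expansion in a region of finite measure converges as soon as the absolute
pinned expansion does almost everywhere: clusters that touch the region where the latter is at most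
`R` are controlled by pinning, and for large `R` the remaining region has small measure. -/
theorem absCluster_lt_top (ν : SigmaFiniteComplexMeasure S)
    (hw : Measurable (Function.uncurry w)) (hsymm : ∀ x y, w x y = w y x)
    (hnorm : ∀ x y, ‖w x y‖ ≤ 1) {Λ : Set S} (hΛ : MeasurableSet Λ) (hν : ν.variation Λ < ⊤)
    (hfin : ∀ᵐ x ∂ν.variation.restrict Λ, absPinned w ν x < ⊤) : absCluster w ν Λ < ⊤ := by
  have hG := measurable_absPinned ν hw
  let B : ℕ → Set S := fun R => Λ ∩ {x | (R : ℝ≥0∞) < absPinned w ν x}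
  have hBm : ∀ R, MeasurableSet (B R) := fun R => hΛ.inter (measurableSet_lt measurable_const hG)
  have hanti : Antitone B := by
    intro R R' h x hx
    have hR : (R : ℝ≥0∞) ≤ R' := Nat.cast_le.2 h
    exact ⟨hx.1, hR.trans_lt hx.2⟩
  have hlim := tendsto_measure_iInter_atTop (μ := ν.variation)
    (fun R => (hBm R).nullMeasurableSet) hanti
    ⟨0, ((measure_mono Set.inter_subset_left).trans_lt hν).ne⟩
  -- The sets `B R` shrink to the points of `Λ` where the pinned expansion is infinite.
  have h0 : ν.variation (⋂ R, B R) = 0 := by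
    rw [ae_restrict_iff' hΛ] at hfin
    refine measure_mono_null ?_ hfin
    intro x hx
    have hx' := Set.mem_iInter.1 hx
    simp only [Set.mem_compl_iff, Set.mem_ofPred_eq, Classical.not_imp, not_lt, top_le_iff]
    refine ⟨(hx' 0).1, ?_⟩
    by_contra hne
    obtain ⟨R, hR⟩ := ENNReal.exists_nat_gt hne
    exact lt_asymm hR (hx' R).2
  rw [h0] at hlim
  obtain ⟨R, hR⟩ := (hlim.eventually_lt_const (show (0 : ℝ≥0∞) < 8⁻¹ by simp)).exists
  have hA : MeasurableSet (Λ ∩ {x | absPinned w ν x ≤ R}) :=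
    hΛ.inter (measurableSet_le hG measurable_const)
  refine (absCluster_le_add ν hw hsymm (B := B R) hA ?_).trans_lt ?_
  · intro x hx
    rcases le_or_gt (absPinned w ν x) R with h | h
    · exact Or.inl ⟨hx, h⟩
    · exact Or.inr ⟨hx, h⟩
  · refine ENNReal.add_lt_top.2 ⟨absCluster_lt_top_of_small ν hw hsymm hnorm (hBm R) hR.le, ?_⟩
    refine (setLIntegral_mono measurable_const fun x hx => hx.2).trans_lt ?_
    rw [setLIntegral_const]
    exact ENNReal.mul_lt_top (ENNReal.natCast_lt_top R)
      ((measure_mono Set.inter_subset_left).trans_lt hν)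

end AbsCluster

/-! ### Power series whose logarithmic derivative is known -/

section PowerSeries

theorem differentiableOn_tsum_mul_pow {c : ℕ → ℂ} (hc : Summable fun n => ‖c n‖) :
    DifferentiableOn ℂ (fun z => ∑' n, c n * z ^ n) (Metric.ball 0 1) := by
  refine Complex.differentiableOn_tsum_of_summable_norm hc (fun n => by fun_prop)
    Metric.isOpen_ball fun n z hz => ?_
  rw [norm_mul, norm_pow]
  exact mul_le_of_le_one_right (norm_nonneg _)
    (pow_le_one₀ (norm_nonneg _) (mem_ball_zero_iff.1 hz).le)

theorem hasSum_deriv_tsum_mul_pow {c : ℕ → ℂ} (hc : Summable fun n => ‖c n‖) {z : ℂ}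
    (hz : z ∈ Metric.ball (0 : ℂ) 1) :
    HasSum (fun n : ℕ => ((n : ℂ) + 1) * c (n + 1) * z ^ n)
      (deriv (fun z => ∑' n, c n * z ^ n) z) := by
  have h := Complex.hasSum_deriv_of_summable_norm (F := fun n z => c n * z ^ n) hc
    (fun n => by fun_prop) Metric.isOpen_ball (fun n z hz => ?_) hz
  · rw [← hasSum_nat_add_iff' 1] at h
    simp only [Finset.range_one, Finset.sum_singleton, pow_zero, mul_one, deriv_const,
      sub_zero] at h
    refine h.congr_fun fun n => ?_
    simp
    ring
  · rw [norm_mul, norm_pow]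
    exact mul_le_of_le_one_right (norm_nonneg _)
      (pow_le_one₀ (norm_nonneg _) (mem_ball_zero_iff.1 hz).le)

theorem continuousOn_tsum_mul_pow {c : ℕ → ℂ} (hc : Summable fun n => ‖c n‖) :
    ContinuousOn (fun z => ∑' n, c n * z ^ n) (Metric.closedBall 0 1) := by
  refine continuousOn_tsum (fun n => by fun_prop) hc fun n z hz => ?_
  rw [norm_mul, norm_pow]
  exact mul_le_of_le_one_right (norm_nonneg _)
    (pow_le_one₀ (norm_nonneg _) (mem_closedBall_zero_iff.1 hz))

theorem tsum_mul_zero_pow (c : ℕ → ℂ) : ∑' n, c n * (0 : ℂ) ^ n = c 0 := by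
  rw [tsum_eq_single 0 fun n hn => by simp [hn]]
  simp

/-- If `a' = c' a` as formal power series, then `exp c = a` on the closed unit disc. -/
theorem exp_tsum_mul_pow {a c : ℕ → ℂ} (ha : Summable fun n => ‖a n‖)
    (hc : Summable fun n => ‖c n‖) (ha0 : a 0 = 1) (hc0 : c 0 = 0)
    (h : ∀ n : ℕ, ((n : ℂ) + 1) * a (n + 1) =
      ∑ ij ∈ Finset.HasAntidiagonal.antidiagonal n, ((ij.1 : ℂ) + 1) * c (ij.1 + 1) * a ij.2)
    {z : ℂ} (hz : z ∈ Metric.closedBall (0 : ℂ) 1) :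
    Complex.exp (∑' n, c n * z ^ n) = ∑' n, a n * z ^ n := by
  set F : ℂ → ℂ := fun z => ∑' n, c n * z ^ n with hF
  set X : ℂ → ℂ := fun z => ∑' n, a n * z ^ n with hX
  have hderiv : ∀ z ∈ Metric.ball (0 : ℂ) 1, deriv X z = deriv F z * X z := by
    intro z hz
    have h1 := hasSum_deriv_tsum_mul_pow ha hz
    have h2 := hasSum_deriv_tsum_mul_pow hc hz
    have h3 : Summable fun n => ‖a n * z ^ n‖ := by
      refine Summable.of_nonneg_of_le (fun _ => norm_nonneg _) (fun n => ?_) ha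
      rw [norm_mul, norm_pow]
      exact mul_le_of_le_one_right (norm_nonneg _)
        (pow_le_one₀ (norm_nonneg _) (mem_ball_zero_iff.1 hz).le)
    -- The hypothesis on the coefficients is the Cauchy product for `X' = F' X`.
    rw [← h1.tsum_eq, ← h2.tsum_eq, hX,
      tsum_mul_tsum_eq_tsum_sum_antidiagonal_of_summable_norm h2.summable.norm h3]
    refine tsum_congr fun n => ?_
    rw [h n, Finset.sum_mul]
    refine Finset.sum_congr rfl fun ij hij => ?_
    rw [← Finset.HasAntidiagonal.mem_antidiagonal.1 hij, pow_add]
    ring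
  have hFd := differentiableOn_tsum_mul_pow hc
  have hXd := differentiableOn_tsum_mul_pow ha
  have hconst : ∀ z ∈ Metric.ball (0 : ℂ) 1, X z * Complex.exp (-F z) = 1 := by
    intro z hz
    have h0 : X 0 * Complex.exp (-F 0) = 1 := by
      simp [hX, hF, tsum_mul_zero_pow, ha0, hc0]
    rw [← h0]
    refine Metric.isOpen_ball.is_const_of_deriv_eq_zero
      (convex_ball (0 : ℂ) 1).isPreconnected (hXd.mul hFd.neg.cexp) (fun z hz => ?_) hz
      (Metric.mem_ball_self one_pos)
    have hFz := (hFd.differentiableAt (Metric.isOpen_ball.mem_nhds hz)).hasDerivAt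
    have hXz := (hXd.differentiableAt (Metric.isOpen_ball.mem_nhds hz)).hasDerivAt
    have := (hXz.mul hFz.neg.cexp).deriv
    refine this.trans ?_
    have h4 := hderiv z hz
    simp only [hX, hF] at h4
    rw [h4]
    simp only [Pi.zero_apply]
    ring
  have heq : Set.EqOn (fun z => Complex.exp (F z)) X (Metric.ball 0 1) := by
    intro z hz
    have := hconst z hz
    rw [Complex.exp_neg] at this
    exact ((mul_inv_eq_one₀ (Complex.exp_ne_zero _)).1 this).symm
  -- The point of interest `z = 1` lies on the boundary, and is reached by continuity of both sides
  -- on the closed disc.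
  refine heq.of_subset_closure (continuousOn_tsum_mul_pow hc).cexp (continuousOn_tsum_mul_pow ha)
    Metric.ball_subset_closedBall ?_ hz
  rw [closure_ball _ one_ne_zero]

end PowerSeries

/-! ### Complex integrals over lists -/

section ComplexIntegrals

variable {S : Type*} [MeasurableSpace S]

/-- A measurable function of lists that is bounded on the lists of any given length. -/
def ListBounded (f : List S → ℂ) : Prop :=
  ListMeasurable f ∧ ∃ C : ℕ → ℝ, ∀ l, ‖f l‖ ≤ C l.length

theorem ListBounded.cons {f : List S → ℂ} (hf : ListBounded f) (x : S) :
    ListBounded fun l => f (x :: l) := by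
  obtain ⟨hm, C, hC⟩ := hf
  exact ⟨hm.cons_right x, fun n => C (n + 1), fun l => hC (x :: l)⟩

theorem norm_splitSum_le {S : Type*} {M : ℝ} (l : List S) : ∀ {K : List S → List S → ℂ},
    (∀ a b, (a ++ b).Perm l → ‖K a b‖ ≤ M) → ‖splitSum l K‖ ≤ 2 ^ l.length * M := by
  induction l with
  | nil => intro K h; simpa [splitSum] using h [] [] (List.Perm.refl _)
  | cons y l ih =>
    intro K h
    rw [splitSum, List.length_cons, pow_succ]
    have h1 := ih (K := fun a b => K (y :: a) b) fun a b hab => h _ _ (hab.cons y)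
    have h2 := ih (K := fun a b => K a (y :: b)) fun a b hab =>
      h _ _ (List.perm_middle.trans (hab.cons y))
    linarith [norm_add_le (splitSum l fun a b => K (y :: a) b) (splitSum l fun a b => K a (y :: b))]

theorem ListBounded.conv {f g : List S → ℂ} (hf : ListBounded f) (hg : ListBounded g) :
    ListBounded (conv f g) := by
  obtain ⟨hfm, C, hC⟩ := hf
  obtain ⟨hgm, D, hD⟩ := hg
  -- There are `2 ^ n` splittings, and the double sum merely dominates every product of bounds for
  -- sublists of length at most `n`.
  refine ⟨hfm.conv hgm, fun n => 2 ^ n * ∑ i ∈ Finset.range (n + 1), ∑ j ∈ Finset.range (n + 1),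
    |C i| * |D j|, fun l => norm_splitSum_le l fun a b hab => ?_⟩
  have hlen := hab.length_eq
  rw [List.length_append] at hlen
  rw [norm_mul]
  calc ‖f a‖ * ‖g b‖ ≤ |C a.length| * |D b.length| :=
        mul_le_mul ((hC a).trans (le_abs_self _)) ((hD b).trans (le_abs_self _)) (norm_nonneg _)
          (abs_nonneg _)
    _ ≤ ∑ j ∈ Finset.range (l.length + 1), |C a.length| * |D j| :=
        Finset.single_le_sum (f := fun j => |C a.length| * |D j|) (fun j _ => by positivity)
          (Finset.mem_range.2 (by omega))
    _ ≤ _ := Finset.single_le_sum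
          (f := fun i => ∑ j ∈ Finset.range (l.length + 1), |C i| * |D j|)
          (fun i _ => by positivity) (Finset.mem_range.2 (by omega))

variable (ρ : Measure S)

/-- The complex integral of a function over the lists of length `n`. -/
def listInt (n : ℕ) (f : List S → ℂ) : ℂ :=
  ∫ y : Fin n → S, f (List.ofFn y) ∂Measure.pi fun _ => ρ

theorem ListBounded.integrable [IsFiniteMeasure ρ] {f : List S → ℂ} (hf : ListBounded f) (n : ℕ) :
    Integrable (fun y : Fin n → S => f (List.ofFn y)) (Measure.pi fun _ => ρ) := by
  obtain ⟨hfm, C, hC⟩ := hf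
  refine Integrable.of_bound (hfm n).aestronglyMeasurable (C n) (Filter.Eventually.of_forall ?_)
  intro y
  simpa using hC (List.ofFn y)

theorem ListBounded.integrable_cons [IsFiniteMeasure ρ] {f : List S → ℂ} (hf : ListBounded f) (n : ℕ) :
    Integrable (fun q : S × (Fin n → S) => f (q.1 :: List.ofFn q.2))
      (ρ.prod (Measure.pi fun _ => ρ)) := by
  obtain ⟨hfm, C, hC⟩ := hf
  refine Integrable.of_bound (hfm.cons n).aestronglyMeasurable (C (n + 1))
    (Filter.Eventually.of_forall ?_)
  intro q
  simpa using hC (q.1 :: List.ofFn q.2)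

theorem listInt_zero (f : List S → ℂ) : listInt ρ 0 f = f [] := by
  simp [listInt, Measure.real]

theorem listInt_succ [IsFiniteMeasure ρ] (n : ℕ) {f : List S → ℂ} (hf : ListBounded f) :
    listInt ρ (n + 1) f = ∫ x, listInt ρ n (fun l => f (x :: l)) ∂ρ := by
  have h := (measurePreserving_piFinSuccAbove (fun _ : Fin (n + 1) => ρ) 0).symm
  rw [listInt, ← h.integral_comp (MeasurableEquiv.measurableEmbedding _)]
  have : ∀ q : S × (Fin n → S),
      f (List.ofFn ((MeasurableEquiv.piFinSuccAbove (fun _ => S) 0).symm q)) =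
        f (q.1 :: List.ofFn q.2) := by
    intro q
    have : (MeasurableEquiv.piFinSuccAbove (fun _ : Fin (n + 1) => S) 0).symm q =
      (Fin.cons q.1 q.2 : Fin (n + 1) → S) := Fin.insertNth_zero' _ _
    rw [this, List.ofFn_cons]
  simp only [this]
  exact integral_prod _ (hf.integrable_cons ρ n)

theorem integrable_listInt_cons [IsFiniteMeasure ρ] (n : ℕ) {f : List S → ℂ} (hf : ListBounded f) :
    Integrable (fun x => listInt ρ n fun l => f (x :: l)) ρ :=
  (hf.integrable_cons ρ n).integral_prod_left

/-- Complex counterpart of `listLint_splitSum`, again by Pascal's rule. Boundedness on lists of each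
length and finiteness of `ρ` provide integrability. -/
theorem listInt_conv [IsFiniteMeasure ρ] (n : ℕ) : ∀ {f g : List S → ℂ}, ListBounded f → ListBounded g →
    listInt ρ n (conv f g) = ∑ ij ∈ Finset.HasAntidiagonal.antidiagonal n,
      (n.choose ij.1 : ℂ) * (listInt ρ ij.1 f * listInt ρ ij.2 g) := by
  induction n with
  | zero =>
    intro f g _ _
    simp [listInt_zero, conv, splitSum]
  | succ n ih =>
    intro f g hf hg
    have hsplit : ∀ x, listInt ρ n (fun l => conv f g (x :: l)) =
        listInt ρ n (conv (fun a => f (x :: a)) g) +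
          listInt ρ n (conv f fun b => g (x :: b)) := fun x =>
      integral_add (((hf.cons x).conv hg).integrable ρ n) ((hf.conv (hg.cons x)).integrable ρ n)
    rw [listInt_succ ρ n (hf.conv hg)]
    simp only [hsplit, ih (hf.cons _) hg, ih hf (hg.cons _)]
    have hi1 : ∀ ij : ℕ × ℕ, Integrable (fun x => (n.choose ij.1 : ℂ) *
        (listInt ρ ij.1 (fun a => f (x :: a)) * listInt ρ ij.2 g)) ρ := fun ij =>
      ((integrable_listInt_cons ρ ij.1 hf).mul_const _).const_mul _
    have hi2 : ∀ ij : ℕ × ℕ, Integrable (fun x => (n.choose ij.1 : ℂ) *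
        (listInt ρ ij.1 f * listInt ρ ij.2 fun b => g (x :: b))) ρ := fun ij =>
      ((integrable_listInt_cons ρ ij.2 hg).const_mul _).const_mul _
    rw [Finset.sum_antidiagonal_choose_succ_mul (fun i j => listInt ρ i f * listInt ρ j g),
      integral_add (integrable_finsetSum _ fun ij _ => hi1 ij)
        (integrable_finsetSum _ fun ij _ => hi2 ij),
      integral_finsetSum _ (fun ij _ => hi1 ij), integral_finsetSum _ (fun ij _ => hi2 ij),
      add_comm]
    congr 1
    · refine Finset.sum_congr rfl fun ij _ => ?_
      rw [integral_const_mul, integral_const_mul, listInt_succ ρ _ hg]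
    · refine Finset.sum_congr rfl fun ij hij => ?_
      rw [integral_const_mul, integral_mul_const, listInt_succ ρ _ hf,
        Nat.choose_symm_of_eq_add (Finset.HasAntidiagonal.mem_antidiagonal.1 hij).symm]

/-- The integrated form of the relation `g (x :: ·) = f (x :: ·) * g`. -/
theorem listInt_succ_of_conv [IsFiniteMeasure ρ] {f g : List S → ℂ} (hf : ListBounded f) (hg : ListBounded g)
    (h : ∀ x l, g (x :: l) = conv (fun a => f (x :: a)) g l) (n : ℕ) :
    listInt ρ (n + 1) g = ∑ ij ∈ Finset.HasAntidiagonal.antidiagonal n,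
      (n.choose ij.1 : ℂ) * (listInt ρ (ij.1 + 1) f * listInt ρ ij.2 g) := by
  have h' : ∀ x, (fun l => g (x :: l)) = conv (fun a => f (x :: a)) g := fun x => funext (h x)
  rw [listInt_succ ρ n hg]
  simp only [h', listInt_conv ρ n (hf.cons _) hg]
  rw [integral_finsetSum _ fun ij _ =>
    ((integrable_listInt_cons ρ ij.1 hf).mul_const _).const_mul _]
  refine Finset.sum_congr rfl fun ij _ => ?_
  rw [integral_const_mul, integral_mul_const, listInt_succ ρ _ hf]

end ComplexIntegrals

/-! ### The logarithm of the partition function -/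

section Logarithm

variable {S : Type*} [MeasurableSpace S] {w : S → S → ℂ}

/-- A connected graph has a vertex. This makes the constant term of the cluster series vanish, hence
the branch is `0` at `z = 0`. -/
theorem listTrunc_nil {S : Type*} (w : S → S → ℂ) : listTrunc w [] = 0 := by
  classical
  rw [listTrunc, truncatedWeight]
  refine Finset.sum_eq_zero fun G hG => ?_
  have hG' : G.Connected := (Finset.mem_filter.1 hG).2
  exact (hG'.nonempty.some).elim0

open Classical in
theorem norm_truncatedWeight_le {S : Type*} {w : S → S → ℂ} (hnorm : ∀ x y, ‖w x y‖ ≤ 1) {n : ℕ}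
    (y : Fin n → S) :
    ‖truncatedWeight w y‖ ≤ ∑ G : SimpleGraph (Fin n) with G.Connected,
      ∏ p : Fin n × Fin n with p.1 < p.2 ∧ G.Adj p.1 p.2, (2 : ℝ) := by
  refine (norm_sum_le _ _).trans (Finset.sum_le_sum fun G _ => ?_)
  rw [norm_prod]
  refine Finset.prod_le_prod (fun _ _ => norm_nonneg _) fun p _ => ?_
  refine (norm_sub_le _ _).trans ?_
  rw [norm_one]
  linarith [hnorm (y p.1) (y p.2)]

theorem norm_listProd_le_one {S : Type*} {f : S → ℂ} (hf : ∀ x, ‖f x‖ ≤ 1) (l : List S) :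
    ‖listProd f l‖ ≤ 1 := by
  induction l with
  | nil => simp
  | cons x l ih =>
    rw [listProd_cons, norm_mul]
    exact mul_le_one₀ (hf x) (norm_nonneg _) ih

theorem norm_listWeight_le_one {S : Type*} {w : S → S → ℂ} (hnorm : ∀ x y, ‖w x y‖ ≤ 1)
    (l : List S) : ‖listWeight w l‖ ≤ 1 := by
  induction l with
  | nil => simp [listWeight]
  | cons x l ih =>
    rw [listWeight, norm_mul]
    exact mul_le_one₀ (norm_listProd_le_one (hnorm x) l) (norm_nonneg _) ih

/-- The truncated weight of a list times its phase. -/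
def phasedTrunc (w : S → S → ℂ) (ν : SigmaFiniteComplexMeasure S) (l : List S) : ℂ :=
  listProd ν.phase l * listTrunc w l

/-- The weight of a list times its phase. -/
def phasedWeight (w : S → S → ℂ) (ν : SigmaFiniteComplexMeasure S) (l : List S) : ℂ :=
  listProd ν.phase l * listWeight w l

theorem norm_phasedWeight_le_one (ν : SigmaFiniteComplexMeasure S)
    (hnorm : ∀ x y, ‖w x y‖ ≤ 1) (l : List S) : ‖phasedWeight w ν l‖ ≤ 1 := by
  rw [phasedWeight, norm_mul]
  exact mul_le_one₀ (norm_listProd_le_one (fun x => (ν.norm_phase x).le) l) (norm_nonneg _)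
    (norm_listWeight_le_one hnorm l)

theorem listBounded_phasedWeight (ν : SigmaFiniteComplexMeasure S)
    (hw : Measurable (Function.uncurry w)) (hnorm : ∀ x y, ‖w x y‖ ≤ 1) :
    ListBounded (phasedWeight w ν) :=
  ⟨fun n => (listMeasurable_listProd ν.measurable_phase n).mul (listMeasurable_listWeight hw n),
    fun _ => 1, norm_phasedWeight_le_one ν hnorm⟩

theorem listBounded_phasedTrunc (ν : SigmaFiniteComplexMeasure S)
    (hw : Measurable (Function.uncurry w)) (hnorm : ∀ x y, ‖w x y‖ ≤ 1) :
    ListBounded (phasedTrunc w ν) := by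
  classical
  refine ⟨fun n => (listMeasurable_listProd ν.measurable_phase n).mul
    (listMeasurable_listTrunc hw n), fun n => ∑ G : SimpleGraph (Fin n) with G.Connected,
      ∏ p : Fin n × Fin n with p.1 < p.2 ∧ G.Adj p.1 p.2, (2 : ℝ), fun l => ?_⟩
  rw [phasedTrunc, norm_mul]
  refine (mul_le_of_le_one_left (norm_nonneg _)
    (norm_listProd_le_one (fun x => (ν.norm_phase x).le) l)).trans ?_
  refine (norm_truncatedWeight_le hnorm l.get).trans (le_of_eq ?_)
  refine Finset.sum_congr (by ext; simp) fun G _ => Finset.prod_congr (by ext; simp) fun _ _ => rfl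

/-- The phase is a multiplicative function of lists, so it is compatible with the convolution in
`conv_listTrunc`. -/
theorem phasedWeight_cons (ν : SigmaFiniteComplexMeasure S) (hsymm : ∀ x y, w x y = w y x) (x : S)
    (l : List S) :
    phasedWeight w ν (x :: l) = conv (fun a => phasedTrunc w ν (x :: a)) (phasedWeight w ν) l := by
  have h : (fun a => phasedTrunc w ν (x :: a)) = fun a =>
      ν.phase x * (listProd ν.phase a * listTrunc w (x :: a)) := by
    funext a
    rw [phasedTrunc, listProd_cons, mul_assoc]
  have h' : phasedWeight w ν = fun a => listProd ν.phase a * listWeight w a := rfl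
  rw [h, conv_const_mul_left, h', conv_listProd_mul, conv_listTrunc hsymm]
  simp only [listProd_cons, listWeight]
  ring

theorem setIntegral_cube (ν : SigmaFiniteComplexMeasure S) (Λ : Set S) (n : ℕ)
    (F : (Fin n → S) → ℂ) :
    ∫ y in cube Λ n, F y ∂ν.variationPow n =
      ∫ y, F y ∂Measure.pi fun _ => ν.variation.restrict Λ := by
  rw [variationPow_restrict_cube]

theorem clusterTerm_eq (ν : SigmaFiniteComplexMeasure S) (Λ : Set S) (n : ℕ) :
    clusterTerm w ν Λ n =
      ((n ! : ℕ) : ℂ)⁻¹ * listInt (ν.variation.restrict Λ) n (phasedTrunc w ν) := by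
  rw [clusterTerm, setIntegral_cube, listInt]
  congr 1
  refine integral_congr_ae (Filter.Eventually.of_forall fun y => ?_)
  simp only [clusterIntegrand, phasedTrunc, listTrunc_ofFn, listProd_ofFn,
    SigmaFiniteComplexMeasure.phasePow]
  exact mul_comm _ _

theorem listInt_phasedWeight (ν : SigmaFiniteComplexMeasure S) (Λ : Set S) (n : ℕ) :
    listInt (ν.variation.restrict Λ) n (phasedWeight w ν) =
      ∫ y in cube Λ n, weight w y * ν.phasePow y ∂ν.variationPow n := by
  rw [setIntegral_cube, listInt]
  refine integral_congr_ae (Filter.Eventually.of_forall fun y => ?_)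
  simp only [phasedWeight, listWeight_ofFn, listProd_ofFn, SigmaFiniteComplexMeasure.phasePow]
  exact mul_comm _ _

theorem norm_listInt_phasedWeight_le (ν : SigmaFiniteComplexMeasure S)
    (hnorm : ∀ x y, ‖w x y‖ ≤ 1) (ρ : Measure S) [IsFiniteMeasure ρ] (n : ℕ) :
    ‖listInt ρ n (phasedWeight w ν)‖ ≤ ρ.real Set.univ ^ n := by
  refine (norm_integral_le_of_norm_le_const
    (Filter.Eventually.of_forall fun y => norm_phasedWeight_le_one ν hnorm _)).trans ?_
  simp [Measure.real, Measure.pi_univ]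

theorem summable_norm_listInt_phasedWeight (ν : SigmaFiniteComplexMeasure S)
    (hnorm : ∀ x y, ‖w x y‖ ≤ 1) (ρ : Measure S) [IsFiniteMeasure ρ] :
    Summable fun n => ‖((n ! : ℕ) : ℂ)⁻¹ * listInt ρ n (phasedWeight w ν)‖ := by
  refine Summable.of_nonneg_of_le (fun _ => norm_nonneg _) (fun n => ?_)
    (Real.summable_pow_div_factorial (ρ.real Set.univ))
  rw [norm_mul, norm_inv, Complex.norm_natCast, div_eq_inv_mul]
  exact mul_le_mul_of_nonneg_left (norm_listInt_phasedWeight_le ν hnorm ρ n) (by positivity)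

theorem partitionFunction_eq_tsum (ν : SigmaFiniteComplexMeasure S)
    (hnorm : ∀ x y, ‖w x y‖ ≤ 1) {Λ : Set S} (hν : ν.variation Λ < ⊤) {z : ℂ}
    (hz : z ∈ Metric.closedBall (0 : ℂ) 1) :
    partitionFunction w ν Λ z = ∑' n : ℕ, ((n ! : ℕ) : ℂ)⁻¹ *
      listInt (ν.variation.restrict Λ) n (phasedWeight w ν) * z ^ n := by
  have : IsFiniteMeasure (ν.variation.restrict Λ) := ⟨by simpa using hν⟩
  have hs : Summable fun n : ℕ => ((n ! : ℕ) : ℂ)⁻¹ *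
      listInt (ν.variation.restrict Λ) n (phasedWeight w ν) * z ^ n := by
    refine Summable.of_norm_bounded (summable_norm_listInt_phasedWeight ν hnorm
      (ν.variation.restrict Λ)) fun n => ?_
    rw [norm_mul, norm_pow]
    exact mul_le_of_le_one_right (norm_nonneg _)
      (pow_le_one₀ (norm_nonneg _) (mem_closedBall_zero_iff.1 hz))
  rw [hs.tsum_eq_zero_add, partitionFunction]
  congr 1
  · simp [listInt_zero, phasedWeight, listWeight]
  · refine tsum_congr fun k => ?_
    rw [listInt_phasedWeight]
    ring

theorem enorm_clusterTerm_le (ν : SigmaFiniteComplexMeasure S) (Λ : Set S) (n : ℕ) :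
    ‖clusterTerm w ν Λ n‖ₑ ≤ ((n ! : ℕ) : ℝ≥0∞)⁻¹ *
      ∫⁻ y in cube Λ n, ‖truncatedWeight w y‖ₑ ∂ν.variationPow n := by
  rw [clusterTerm, enorm_mul, enorm_inv_factorial]
  refine mul_le_mul' le_rfl ((enorm_integral_le_lintegral_enorm _).trans (le_of_eq ?_))
  refine lintegral_congr fun y => ?_
  rw [clusterIntegrand, enorm_mul, norm_phasePow, mul_one]

theorem tsum_enorm_clusterTerm_le (ν : SigmaFiniteComplexMeasure S) (Λ : Set S) :
    ∑' n, ‖clusterTerm w ν Λ (n + 1)‖ₑ ≤ absCluster w ν Λ :=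
  ENNReal.tsum_le_tsum fun n => enorm_clusterTerm_le ν Λ (n + 1)

theorem integrableOn_clusterIntegrand (ν : SigmaFiniteComplexMeasure S)
    (hw : Measurable (Function.uncurry w)) {Λ : Set S} (h : absCluster w ν Λ < ⊤) (n : ℕ) :
    IntegrableOn (clusterIntegrand w ν (n + 1)) (cube Λ (n + 1)) (ν.variationPow (n + 1)) := by
  refine ⟨((measurable_truncatedWeight hw (n + 1)).mul
    (measurable_phasePow ν (n + 1))).aestronglyMeasurable, ?_⟩
  rw [hasFiniteIntegral_iff_enorm]
  have h' := (ENNReal.le_tsum n).trans_lt h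
  refine lt_of_eq_of_lt (lintegral_congr fun y => ?_) (lintegral_lt_top_of_inv_factorial_mul h')
  rw [clusterIntegrand, enorm_mul, norm_phasePow, mul_one]

theorem inv_factorial_mul_choose_complex {n i j : ℕ} (h : i + j = n) :
    ((n : ℂ) + 1) * ((((n + 1)! : ℕ) : ℂ)⁻¹ * (n.choose i : ℂ)) =
      ((i : ℂ) + 1) * ((((i + 1)! : ℕ) : ℂ)⁻¹ * ((j ! : ℕ) : ℂ)⁻¹) := by
  subst h
  have hne : ∀ k : ℕ, ((k ! : ℕ) : ℂ) ≠ 0 := fun k => by exact_mod_cast k.factorial_ne_zero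
  have hs : ∀ k : ℕ, ((k : ℂ) + 1) ≠ 0 := fun k => by exact_mod_cast k.succ_ne_zero
  have key : ((i + j).choose i : ℂ) * (i ! : ℕ) * (j ! : ℕ) = ((i + j)! : ℕ) := by
    rw [Nat.choose_symm_add]
    exact_mod_cast Nat.add_choose_mul_factorial_mul_factorial i j
  have hi := hne i
  have hj := hne j
  have hij := hne (i + j)
  have hsi := hs i
  have hsij := hs (i + j)
  rw [Nat.factorial_succ, Nat.factorial_succ, Nat.cast_mul, Nat.cast_mul]
  push_cast at hsij key ⊢
  field_simp
  linear_combination key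

/-- The cluster expansion of the logarithm of the partition function. -/
theorem isLogPartitionFunction_tsum (ν : SigmaFiniteComplexMeasure S)
    (hw : Measurable (Function.uncurry w)) (hsymm : ∀ x y, w x y = w y x)
    (hnorm : ∀ x y, ‖w x y‖ ≤ 1) {Λ : Set S} (hν : ν.variation Λ < ⊤)
    (hs : Summable fun n => ‖clusterTerm w ν Λ (n + 1)‖) :
    IsLogPartitionFunction w ν Λ (∑' n, clusterTerm w ν Λ (n + 1)) := by
  have : IsFiniteMeasure (ν.variation.restrict Λ) := ⟨by simpa using hν⟩
  have hc0 : clusterTerm w ν Λ 0 = 0 := by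
    rw [clusterTerm_eq, listInt_zero, phasedTrunc, listTrunc_nil, mul_zero, mul_zero]
  have hc : Summable fun n => ‖clusterTerm w ν Λ n‖ := (summable_nat_add_iff 1).1 hs
  refine ⟨fun z => ∑' n, clusterTerm w ν Λ n * z ^ n, continuousOn_tsum_mul_pow hc, ?_, ?_, ?_⟩
  · simp only [tsum_mul_zero_pow, hc0]
  · intro z hz
    rw [partitionFunction_eq_tsum ν hnorm hν hz]
    refine exp_tsum_mul_pow (summable_norm_listInt_phasedWeight ν hnorm _) hc ?_ hc0 ?_ hz
    · simp [listInt_zero, phasedWeight, listWeight]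
    · intro n
      -- The integrated root recursion, divided by factorials, is the coefficient identity `(n+1)
      -- a_{n+1} = ∑ (i+1) c_{i+1} a_j`.
      rw [listInt_succ_of_conv _ (listBounded_phasedTrunc ν hw hnorm)
        (listBounded_phasedWeight ν hw hnorm) (phasedWeight_cons ν hsymm), Finset.mul_sum,
        Finset.mul_sum]
      refine Finset.sum_congr rfl fun ij hij => ?_
      rw [clusterTerm_eq]
      linear_combination (listInt (ν.variation.restrict Λ) (ij.1 + 1) (phasedTrunc w ν) *
        listInt (ν.variation.restrict Λ) ij.2 (phasedWeight w ν)) *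
        inv_factorial_mul_choose_complex (Finset.HasAntidiagonal.mem_antidiagonal.1 hij)
  · simp only [one_pow, mul_one]
    rw [hc.of_norm.tsum_eq_zero_add, hc0, zero_add]

end Logarithm

end PinnedCluster

end

open MeasureTheory PinnedCluster in
theorem mainTheorem3 {S : Type*} [MeasurableSpace S]
    (ν : SigmaFiniteComplexMeasure S)
    (w : S → S → ℂ)
    (hw_meas : Measurable (Function.uncurry w))
    (hw_symm : ∀ x y, w x y = w y x)
    (hw_norm : ∀ x y, ‖w x y‖ ≤ 1)
    (μ : S → ENNReal)
    (hμ : ∀ x, vertexSum w ν μ x ≤ μ x) :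
    -- (i) the pinned expansion
    (∀ x, ‖pinned w ν x‖ₑ ≤ absPinned w ν x ∧ absPinned w ν x ≤ μ x) ∧
    (∀ x, μ x < ⊤ →
      (∀ n, Integrable (pinnedIntegrand w ν x n) (ν.variationPow n)) ∧
      Summable fun n => ‖pinnedTerm w ν x n‖) ∧
    -- (ii) the cluster expansions
    (∀ Λ : Set S, MeasurableSet Λ → ν.variation Λ < ⊤ →
      absCluster w ν Λ ≤ ∫⁻ x in Λ, μ x ∂ν.variation ∧
      ((∀ᵐ x ∂ν.variation.restrict Λ, μ x < ⊤) →
        absCluster w ν Λ < ⊤ ∧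
        (∀ n, IntegrableOn (clusterIntegrand w ν (n + 1)) (cube Λ (n + 1))
          (ν.variationPow (n + 1))) ∧
        (Summable fun n => ‖clusterTerm w ν Λ (n + 1)‖) ∧
        ∃ ℓ : ℂ, IsLogPartitionFunction w ν Λ ℓ ∧
          HasSum (fun n => clusterTerm w ν Λ (n + 1)) ℓ ∧
          ‖ℓ‖ₑ ≤ absCluster w ν Λ)) := by
  have hle := absPinned_le ν hw_meas hw_symm hw_norm hμ
  refine ⟨fun x => ⟨enorm_pinned_le ν x, hle x⟩, fun x hx => ?_, fun Λ hΛ hνΛ => ⟨?_, ?_⟩⟩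
  · have hx' := (hle x).trans_lt hx
    exact ⟨integrable_pinnedIntegrand ν hw_meas hx', summable_pinnedTerm ν hx'⟩
  · exact (absCluster_le_lintegral_absPinned ν hw_meas hw_symm hΛ).trans
      (lintegral_mono fun x => hle x)
  · intro hfin
    -- Finiteness cannot be read off from the bound by `∫_Λ μ`, which may be infinite.
    have hlt := absCluster_lt_top ν hw_meas hw_symm hw_norm hΛ hνΛ
      (hfin.mono fun x hx => (hle x).trans_lt hx)
    have hsum := summable_norm_of_tsum_enorm_lt_top
      ((tsum_enorm_clusterTerm_le ν Λ).trans_lt hlt)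
    exact ⟨hlt, integrableOn_clusterIntegrand ν hw_meas hlt, hsum, _,
      isLogPartitionFunction_tsum ν hw_meas hw_symm hw_norm hνΛ hsum, hsum.of_norm.hasSum,
      enorm_tsum_le_tsum_enorm.trans (tsum_enorm_clusterTerm_le ν Λ)⟩
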